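/- Let $G=\{\begin{pmatrix}a&b\\0&1\end{pmatrix}\}$ be the $ax+b$ group over $\mathbb{Q}$, with group law $(a,b)\cdot(u_1,u_2)=(au_1,\,au_2+b)$. Let $X$ be a smooth projective variety over $\mathbb{Q}$ with a right action of $G$ and a $G$-equivariant open immersion $G\to X$ with dense image. View the coordinates $a,b$ of $G$ as rational functions on $X$, and let $D_{\mathfrak j}$ be an irreducible component (over $\mathbb{Q}$) of the boundary $D=X\setminus G$, with its reduced scheme structure. Then $D_{\mathfrak j}$ has codimension $1$ in $X$, so that the order $\operatorname{ord}_{D_{\mathfrak j}}$ of rational functions on $X$ along $D_{\mathfrak j}$ is defined. Let $c\in\mathbb{Q}$ be such that $\operatorname{ord}_{D_{\mathfrak j}}(b-c)\ge\operatorname{ord}_{D_{\mathfrak j}}(b-c')$ for all $c'\in\mathbb{Q}$. Put $$e_1=\operatorname{ord}_{D_{\mathfrak j}}(a),\qquad e_2=\operatorname{ord}_{D_{\mathfrak j}}(b-c),\qquad F=\frac{(b-c)^{e_1}}{a^{e_2}}.$$ 1. There is a dense open set $U\subseteq X$ with $U\cap D_{\mathfrak j}\neq\emptyset$ and $F\in\Gamma(U,\mathcal{O}_X)^\times$.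 2. Assume that $D_{\mathfrak j}$ is geometrically irreducible (as is every boundary component if $X$ is split, i.e. if $\operatorname{Pic}(X)=\operatorname{Pic}(X_{\overline{\mathbb{Q}}})$), or that $e_2\neq 0$. Then for each $U$ as in 1, the rational map $f\colon D_{\mathfrak j}\dashrightarrow\mathbb{P}^1_{\mathbb{Q}}$ extending $F|_{U\cap D_{\mathfrak j}}$ is nonconstant: no representative of $f$ on a dense open subset of $D_{\mathfrak j}$ has image a single point of $\mathbb{P}^1_{\mathbb{Q}}$. -/

import Mathlib

namespace AxB

open AlgebraicGeometry CategoryTheory TopologicalSpace TensorProduct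
open MonoidalCategory CartesianMonoidalCategory MonObj

/-- The coordinate ring `ℚ[a, a⁻¹, b]` of the `ax + b` group over `ℚ`. -/
def CoordRing : Type :=
  Localization.Away (MvPolynomial.X 0 : MvPolynomial (Fin 2) ℚ)

namespace CoordRing

noncomputable instance : CommRing CoordRing :=
  inferInstanceAs (CommRing (Localization.Away (MvPolynomial.X 0 : MvPolynomial (Fin 2) ℚ)))

noncomputable instance : Algebra ℚ CoordRing :=
  inferInstanceAs (Algebra ℚ (Localization.Away (MvPolynomial.X 0 : MvPolynomial (Fin 2) ℚ)))

noncomputable instance : Algebra (MvPolynomial (Fin 2) ℚ) CoordRing :=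
  inferInstanceAs (Algebra (MvPolynomial (Fin 2) ℚ)
    (Localization.Away (MvPolynomial.X 0 : MvPolynomial (Fin 2) ℚ)))

instance : IsScalarTower ℚ (MvPolynomial (Fin 2) ℚ) CoordRing :=
  inferInstanceAs (IsScalarTower ℚ (MvPolynomial (Fin 2) ℚ)
    (Localization.Away (MvPolynomial.X 0 : MvPolynomial (Fin 2) ℚ)))

instance : IsLocalization.Away (MvPolynomial.X 0 : MvPolynomial (Fin 2) ℚ) CoordRing :=
  inferInstanceAs (IsLocalization.Away (MvPolynomial.X 0 : MvPolynomial (Fin 2) ℚ)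
    (Localization.Away (MvPolynomial.X 0 : MvPolynomial (Fin 2) ℚ)))

/-- The coordinate function `a`. -/
noncomputable def a : CoordRing := algebraMap (MvPolynomial (Fin 2) ℚ) CoordRing (.X 0)

/-- The coordinate function `b`. -/
noncomputable def b : CoordRing := algebraMap (MvPolynomial (Fin 2) ℚ) CoordRing (.X 1)

theorem isUnit_a : IsUnit a := IsLocalization.Away.algebraMap_isUnit _

instance : IsDomain CoordRing :=
  IsLocalization.isDomain_of_le_nonZeroDivisors (R := MvPolynomial (Fin 2) ℚ)
    (M := Submonoid.powers (MvPolynomial.X 0)) CoordRing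
    (powers_le_nonZeroDivisors_of_noZeroDivisors (MvPolynomial.X_ne_zero 0))

theorem algHom_ext {B : Type*} [CommRing B] [Algebra ℚ B] {f g : CoordRing →ₐ[ℚ] B}
    (ha : f a = g a) (hb : f b = g b) : f = g := by
  apply IsLocalization.algHom_ext (Submonoid.powers (MvPolynomial.X 0 : MvPolynomial (Fin 2) ℚ))
  apply MvPolynomial.algHom_ext
  intro i
  fin_cases i
  · exact ha
  · exact hb

/-- The homomorphism of `ℚ`-algebras sending `a` to the unit `u` and `b` to `v`. -/
noncomputable def lift {B : Type*} [CommRing B] [Algebra ℚ B] (u v : B) (hu : IsUnit u) :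
    CoordRing →ₐ[ℚ] B :=
  IsLocalization.liftAlgHom (M := Submonoid.powers (MvPolynomial.X 0 : MvPolynomial (Fin 2) ℚ))
    (f := MvPolynomial.aeval ![u, v]) (by
      rintro ⟨_, n, rfl⟩
      simpa using hu.pow n)

section
variable {B : Type*} [CommRing B] [Algebra ℚ B] (u v : B) (hu : IsUnit u)

@[simp] theorem lift_a : lift u v hu a = u := by
  simp [lift, a]

@[simp] theorem lift_b : lift u v hu b = v := by
  simp [lift, b]

end

theorem isUnit_a_tmul_a : IsUnit (a ⊗ₜ[ℚ] a) := by
  have h : a ⊗ₜ[ℚ] a = (a ⊗ₜ[ℚ] 1) * ((1 : CoordRing) ⊗ₜ[ℚ] a) := by simp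
  rw [h]
  exact (isUnit_a.map (Algebra.TensorProduct.includeLeft (R := ℚ) (S := ℚ))).mul
    (isUnit_a.map (Algebra.TensorProduct.includeRight (R := ℚ)))

/-- The bialgebra structure dual to the group law `(a, b) * (u₁, u₂) = (a u₁, a u₂ + b)`, with
unit `(1, 0)`: the first tensor factor carries `(a, b)`, the second one `(u₁, u₂)`. -/
noncomputable instance : Bialgebra ℚ CoordRing :=
  Bialgebra.ofAlgHom
    (lift (a ⊗ₜ[ℚ] a) (a ⊗ₜ[ℚ] b + b ⊗ₜ[ℚ] 1) isUnit_a_tmul_a)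
    (lift 1 0 isUnit_one)
    (by apply algHom_ext <;> simp [TensorProduct.tmul_add, TensorProduct.add_tmul, add_assoc,
          Algebra.TensorProduct.one_def])
    (by apply algHom_ext <;> simp)
    (by apply algHom_ext <;> simp)

theorem comul_a : Coalgebra.comul (R := ℚ) a = a ⊗ₜ[ℚ] a := lift_a _ _ isUnit_a_tmul_a

theorem comul_b : Coalgebra.comul (R := ℚ) b = a ⊗ₜ[ℚ] b + b ⊗ₜ[ℚ] 1 :=
  lift_b _ _ isUnit_a_tmul_a

theorem counit_a : Coalgebra.counit (R := ℚ) a = 1 := lift_a _ _ isUnit_one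

theorem counit_b : Coalgebra.counit (R := ℚ) b = 0 := lift_b _ _ isUnit_one

theorem a_mul_inverse : a * Ring.inverse a = 1 := Ring.mul_inverse_cancel _ isUnit_a

/-- The antipode is dual to the inverse `(a, b)⁻¹ = (a⁻¹, -b a⁻¹)`. -/
noncomputable instance : HopfAlgebra ℚ CoordRing :=
  HopfAlgebra.ofAlgHom
    (lift (Ring.inverse a) (-b * Ring.inverse a) isUnit_a.ringInverse)
    (by
      have h := a_mul_inverse
      apply algHom_ext <;>
        simp only [AlgHom.comp_apply, Bialgebra.comulAlgHom_apply,
          Bialgebra.counitAlgHom_apply, comul_a, comul_b, counit_a, counit_b]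
      · simp; linear_combination h
      · simp; ring)
    (by
      have h := a_mul_inverse
      apply algHom_ext <;>
        simp only [AlgHom.comp_apply, Bialgebra.comulAlgHom_apply,
          Bialgebra.counitAlgHom_apply, comul_a, comul_b, counit_a, counit_b]
      · simp; linear_combination h
      · simp; linear_combination (-b) * h)

end CoordRing

/-- The `ax + b` group `G = Spec ℚ[a, a⁻¹, b]` over `ℚ`. Its group structure (a `GrpObj` instance,
found by type class inference) is the one given by the Hopf algebra structure above. -/
noncomputable abbrev G : Over (Spec (.of ℚ)) := (Spec (.of CoordRing)).asOver (Spec (.of ℚ))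

instance : IsIntegral G.left := inferInstanceAs (IsIntegral (Spec (.of CoordRing)))

section Projective

attribute [local instance] MvPolynomial.gradedAlgebra

/-- Projective space `ℙⁿ` over `ℚ`, the `Proj` of `ℚ[x₀, …, xₙ]`. -/
noncomputable def ProjSpace (n : ℕ) : Over (Spec (.of ℚ)) :=
  Over.mk (Y := Proj (MvPolynomial.homogeneousSubmodule (Fin (n + 1)) ℚ))
    (Proj.toSpecZero (MvPolynomial.homogeneousSubmodule (Fin (n + 1)) ℚ) ≫
      Spec.map (CommRingCat.ofHom
        (algebraMap ℚ (MvPolynomial.homogeneousSubmodule (Fin (n + 1)) ℚ 0))))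

theorem map_irrelevant_eq_top {R : Type} [CommRing R] (f : MvPolynomial (Fin 2) ℚ →+* R)
    (h : f (.X 1) = 1) :
    (HomogeneousIdeal.irrelevant
      (MvPolynomial.homogeneousSubmodule (Fin 2) ℚ)).toIdeal.map f = ⊤ := by
  rw [Ideal.eq_top_iff_one, ← h]
  apply Ideal.mem_map_of_mem
  exact HomogeneousIdeal.mem_irrelevant_of_mem
    (MvPolynomial.homogeneousSubmodule (Fin 2) ℚ) one_pos (MvPolynomial.isHomogeneous_X ℚ (1 : Fin 2))

/-- The morphism `[f : 1] : T ⟶ ℙ¹` attached to a regular function `f` on a `ℚ`-scheme `T`. -/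
noncomputable def toP1 {T : Scheme.{0}} (π : T ⟶ Spec (.of ℚ)) (f : Γ(T, ⊤)) :
    T ⟶ (ProjSpace 1).left :=
  Proj.fromOfGlobalSections (MvPolynomial.homogeneousSubmodule (Fin 2) ℚ)
    (MvPolynomial.eval₂Hom ((Scheme.ΓSpecIso (.of ℚ)).inv ≫ π.appTop).hom ![f, 1])
    (map_irrelevant_eq_top _ (by simp))

end Projective

/-- A rational map is constant if one of its representatives maps its whole domain of definition
to a single point. -/
def IsConstant {Y Z : Scheme.{0}} (f : Y ⤏ Z) : Prop :=
  ∃ g : Y.PartialMap Z, g.toRationalMap = f ∧ ∃ z : Z, ∀ y, g.hom y = z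

/-- A smooth, projective, right-sided equivariant compactification `X` of `G` over `ℚ`: a smooth
projective variety `X` over `ℚ` with a right action of `G` and a dense open immersion `G ⟶ X`
which is equivariant for right translation on `G`. -/
structure Compactification where
  /-- The variety `X`. -/
  X : Over (Spec (.of ℚ))
  isIntegral : IsIntegral X.left
  smooth : Smooth X.hom
  projective : ∃ (n : ℕ) (i : X ⟶ ProjSpace n), IsClosedImmersion i.left
  /-- The right action `(x, g) ↦ x g`. -/
  act : X ⊗ G ⟶ X
  act_one : (X ◁ η[G]) ≫ act = (ρ_ X).hom
  act_mul : (act ▷ G) ≫ act = (α_ X G G).hom ≫ (X ◁ μ[G]) ≫ act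
  /-- The inclusion of `G`. -/
  incl : G ⟶ X
  isOpenImmersion : IsOpenImmersion incl.left
  isDominant : IsDominant incl.left
  incl_act : (incl ▷ G) ≫ act = μ[G] ≫ incl

namespace Compactification

variable (C : Compactification)

instance : IsIntegral C.X.left := C.isIntegral

instance : Smooth C.X.hom := C.smooth

instance : IsOpenImmersion C.incl.left := C.isOpenImmersion

instance : IsLocallyNoetherian C.X.left :=
  LocallyOfFiniteType.isLocallyNoetherian (Y := Spec (.of ℚ)) C.X.hom

instance : Nonempty (C.incl.left ''ᵁ ⊤ : C.X.left.Opens) :=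
  ⟨⟨C.incl.left (genericPoint G.left), ⟨_, trivial, rfl⟩⟩⟩

/-- The function field `Rat(X)`. -/
noncomputable abbrev FunField : Type := C.X.left.functionField

/-- Regular functions on `G`, viewed as rational functions on `X`. -/
noncomputable def ofG : CoordRing →+* C.FunField :=
  ((Scheme.ΓSpecIso (.of CoordRing)).inv ≫ (C.incl.left.appIso ⊤).inv ≫
    C.X.left.germToFunctionField (C.incl.left ''ᵁ ⊤)).hom

/-- The coordinate `a` as a rational function on `X`. -/
noncomputable def a : C.FunField := C.ofG CoordRing.a

/-- The coordinate `b` as a rational function on `X`. -/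
noncomputable def b : C.FunField := C.ofG CoordRing.b

/-- The boundary `D = X \ G`. -/
def boundary : Set C.X.left := (Set.range C.incl.left)ᶜ

/-- The irreducible components of the boundary `D`. -/
structure J where
  /-- The underlying closed subset of `X`. -/
  carrier : Closeds C.X.left
  maximal : Maximal (fun s : Set C.X.left => IsIrreducible s ∧ s ⊆ C.boundary) carrier

namespace J

variable {C} (j : C.J)

theorem isIrreducible : IsIrreducible (j.carrier : Set C.X.left) := j.maximal.1.1

/-- The generic point of the boundary component `D_j`. -/
noncomputable def point : C.X.left := j.isIrreducible.genericPoint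

/-- The order of vanishing along `D_j` of a rational function on `X`. -/
noncomputable def ord (f : C.FunField) : ℤ := Scheme.ord (X := C.X.left) f j.point

/-- The rational numbers `c` that maximize `ord_{D_j}(b - c)`. -/
def argmaxOrd : Set ℚ :=
  {c | ∀ c' : ℚ, j.ord (C.b - (c' : C.FunField)) ≤ j.ord (C.b - (c : C.FunField))}

/-- The component `D_j` with its reduced induced scheme structure. -/
noncomputable def D : Scheme := (Scheme.IdealSheafData.vanishingIdeal j.carrier).subscheme

/-- The closed immersion `D_j ⟶ X`. -/
noncomputable def emb : j.D ⟶ C.X.left :=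
  (Scheme.IdealSheafData.vanishingIdeal j.carrier).subschemeι

/-- The structure morphism `D_j ⟶ Spec ℚ`. -/
noncomputable def π : j.D ⟶ Spec (.of ℚ) := j.emb ≫ C.X.hom

theorem range_emb : Set.range j.emb = (j.carrier : Set C.X.left) := by
  have h := (Scheme.IdealSheafData.vanishingIdeal j.carrier).range_subschemeι
  rw [Scheme.IdealSheafData.coe_support_vanishingIdeal] at h
  exact h

instance : IrreducibleSpace j.D := by
  have h : IsIrreducible
      ((Scheme.IdealSheafData.vanishingIdeal j.carrier).support : Set C.X.left) := by
    simpa using j.isIrreducible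
  exact Subtype.irreducibleSpace h

/-- A realization of the rational function `F` as an invertible regular function on a dense open
set `U` of `X` that meets `D_j`. -/
structure UnitNear (F : C.FunField) where
  /-- The open set. -/
  U : C.X.left.Opens
  dense : Dense (U : Set C.X.left)
  meets : ((U : Set C.X.left) ∩ j.carrier).Nonempty
  [nonempty : Nonempty U]
  /-- The regular function on `U`. -/
  f : Γ(C.X.left, U)
  isUnit : IsUnit f
  eq : C.X.left.germToFunctionField U f = F

variable {j}

/-- The restriction of `F` to `U ∩ D_j`, as a partial map from `D_j` to `ℙ¹`. -/
noncomputable def UnitNear.partialMap {F : C.FunField} (M : j.UnitNear F) :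
    j.D.PartialMap (ProjSpace 1).left where
  domain := j.emb ⁻¹ᵁ M.U
  dense_domain := by
    refine (j.emb ⁻¹ᵁ M.U).isOpen.dense ?_
    obtain ⟨x, hxU, hxZ⟩ := M.meets
    rw [← j.range_emb] at hxZ
    obtain ⟨y, rfl⟩ := hxZ
    exact ⟨y, hxU⟩
  hom := toP1 ((j.emb ⁻¹ᵁ M.U).ι ≫ j.π) ((j.emb ⁻¹ᵁ M.U).topIso.inv (j.emb.app M.U M.f))

/-- The rational map from `D_j` to `ℙ¹` that extends the restriction of `F` to `U ∩ D_j`. -/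
noncomputable def UnitNear.ratMap {F : C.FunField} (M : j.UnitNear F) :
    j.D ⤏ (ProjSpace 1).left :=
  M.partialMap.toRationalMap

end J

end Compactification

end AxB

/-! ### Commutative algebra: normality of smooth algebras, and a criterion for discrete valuation
rings. -/

section
open TensorProduct nonZeroDivisors

/-! Let `ξ` be the generic point of `D_j`. Its local ring in `X` is normal, since `X` is smooth. One
of `a`, `a⁻¹`, `b` is not regular at `ξ`: otherwise, `X` being separated, `ξ` would lie in the
affine open `G`. That function is regular at every proper generization of `ξ`, as these lie in `G`,
so the local ring is a discrete valuation ring (`Scheme.isDiscreteValuationRing_stalk`). This is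
codimension one. As `ord F = e₁ e₂ - e₂ e₁ = 0`, `F` is a unit at `ξ`, hence on a neighbourhood.

Suppose the map given by `F` on `D_j` is constant. At a closed point the value of `F` is algebraic
over `ℚ`, so some nonzero rational polynomial `P` kills it; by constancy `P(F)` vanishes at `ξ` too
(`exists_eval₂_mem_maximalIdeal`). Two cases contradict this.

If `e₂ ≠ 0`, right translation by `(t, 0)` fixes `b` and multiplies `a` by `t`, so it multiplies `F`
by `t ^ (-e₂)`. It permutes the finitely many boundary components, so some `t = 2 ^ n` with `n ≠ 0`
fixes `ξ`. Then `P` has infinitely many roots in the residue field (`J.eval₂_notMem_maximalIdeal`).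

If `e₂ = 0`, then `e₁ ≠ 0` and `b - c` is a unit at `ξ` whose residue is algebraic over `ℚ`.
Geometric irreducibility makes this residue a rational number `q` (`exists_sub_mem_maximalIdeal`),
so `b - (c + q)` has positive order, against the maximality at `c`. -/

/-- With `K = Frac R`, the domain `S ⊗ K` is étale over a field, so it is a field, namely `Frac S`.
Integral closure commutes with smooth base change, so the closure of `S` there is `S ⊗ R = S`. -/
theorem IsIntegrallyClosed.of_etale (R S : Type*) [CommRing R] [CommRing S] [Algebra R S]
    [IsDomain R] [IsDomain S] [IsIntegrallyClosed R] [Algebra.Etale R S] :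
    IsIntegrallyClosed S := by
  let K := FractionRing R
  let T := S ⊗[R] K
  have hfl : Module.Flat R S := inferInstance
  have hinj : Function.Injective (algebraMap R S) := FaithfulSMul.algebraMap_injective R S
  have hle : Algebra.algebraMapSubmonoid S R⁰ ≤ S⁰ := by
    rintro _ ⟨r, hr, rfl⟩
    exact mem_nonZeroDivisors_of_ne_zero fun h =>
      nonZeroDivisors.ne_zero hr (hinj (by simpa using h))
  have : IsLocalization (Algebra.algebraMapSubmonoid S R⁰) T := inferInstance
  have : IsDomain T := IsLocalization.isDomain_of_le_nonZeroDivisors T hle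
  let : Algebra K T := Algebra.TensorProduct.rightAlgebra
  have : Algebra.Etale K T := .of_equiv (Algebra.TensorProduct.commRight R K S)
  have : Module.Finite K T := Algebra.FormallyUnramified.finite_of_free K T
  have hT : IsField T := isField_of_isIntegral_of_isField' (R := K) (Field.toIsField K)
  have hST : Function.Injective (algebraMap S T) := IsLocalization.injective T hle
  have : IsFractionRing S T := by
    refine IsLocalization.of_le (Algebra.algebraMapSubmonoid S R⁰) S⁰ hle fun s hs => ?_
    obtain ⟨y, hy⟩ := hT.mul_inv_cancel
      (a := algebraMap S T s) fun h => nonZeroDivisors.ne_zero hs (hST (h.trans (map_zero _).symm))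
    exact .of_mul_eq_one y hy
  rw [isIntegrallyClosed_iff_isIntegrallyClosedIn T]
  have : IsIntegrallyClosedIn R K := (isIntegrallyClosed_iff_isIntegrallyClosedIn K).mp ‹_›
  refine isIntegrallyClosedIn_iff.mpr ⟨hST, fun {x} hx => ?_⟩
  obtain ⟨y, hy⟩ := (TensorProduct.toIntegralClosure_bijective_of_smooth (R := R) (S := S)
    (B := K)).2 ⟨x, hx⟩
  have key : ∀ y : S ⊗[R] integralClosure R K, ∃ s, algebraMap S T s =
      (TensorProduct.toIntegralClosure R S K y : T) := by
    intro y
    induction y with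
    | zero => exact ⟨0, by simp⟩
    | add a b ha hb =>
      obtain ⟨s, hs⟩ := ha
      obtain ⟨t, ht⟩ := hb
      exact ⟨s + t, by simp [hs, ht]⟩
    | tmul s k =>
      obtain ⟨r, hr⟩ := IsIntegrallyClosedIn.algebraMap_eq_of_integral k.2
      refine ⟨r • s, ?_⟩
      simp only [TensorProduct.toIntegralClosure, AlgHom.coe_codRestrict,
        Algebra.TensorProduct.map_tmul, Subalgebra.coe_val, AlgHom.coe_id, id]
      rw [← hr, Algebra.algebraMap_eq_smul_one (A := K), tmul_smul, smul_tmul']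
      rfl
  obtain ⟨s, hs⟩ := key y
  exact ⟨s, by rw [hs, hy]⟩

/-- Normality is local, and near each maximal ideal a smooth algebra is étale over a polynomial
ring, which is normal. -/
theorem Algebra.Smooth.isIntegrallyClosed (k S : Type*) [Field k] [CommRing S] [Algebra k S]
    [IsDomain S] [Algebra.Smooth k S] : IsIntegrallyClosed S := by
  have h (m : Ideal S) [m.IsMaximal] : IsIntegrallyClosed (Localization.AtPrime m) := by
    obtain ⟨f, hfm, n, _, _, _⟩ :=
      Algebra.IsSmoothAt.exists_isStandardEtale_mvPolynomial (R := k) (p := m)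
    have hf : Submonoid.powers f ≤ S⁰ := by
      apply powers_le_nonZeroDivisors_of_noZeroDivisors
      rintro rfl
      exact hfm m.zero_mem
    have : IsDomain (Localization.Away f) := IsLocalization.isDomain_localization hf
    have : IsIntegrallyClosed (Localization.Away f) := .of_etale (MvPolynomial (Fin n) k) _
    have hfm' : Submonoid.powers f ≤ m.primeCompl := Submonoid.powers_le.mpr hfm
    let := IsLocalization.localizationAlgebraOfSubmonoidLe (Localization.Away f)
      (Localization.AtPrime m) _ _ hfm'
    have := IsLocalization.localization_isScalarTower_of_submonoid_le (Localization.Away f)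
      (Localization.AtPrime m) _ _ hfm'
    have := IsLocalization.isLocalization_of_submonoid_le (Localization.Away f)
      (Localization.AtPrime m) _ _ hfm'
    refine isIntegrallyClosed_of_isLocalization (R := Localization.Away f) _ (m.primeCompl.map
      (algebraMap S (Localization.Away f))) ?_
    rintro _ ⟨r, hr, rfl⟩
    refine mem_nonZeroDivisors_of_ne_zero fun h => hr ?_
    have := IsLocalization.injective (Localization.Away f) hf (h.trans (map_zero _).symm)
    exact this ▸ m.zero_mem
  exact .of_localization_maximal fun p _ _ => h p

theorem IsDiscreteValuationRing.of_forall_maximalIdeal_pow_mul_mem {A K : Type*} [CommRing A]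
    [IsDomain A] [IsLocalRing A] [IsNoetherianRing A] [IsIntegrallyClosed A] [Field K]
    [Algebra A K] [IsFractionRing A K] (hA : ¬ IsField A) (g : K) (hg : g ∉ (algebraMap A K).range)
    (n : ℕ) (hn : ∀ x ∈ IsLocalRing.maximalIdeal A ^ n, x • g ∈ (algebraMap A K).range) :
    IsDiscreteValuationRing A := by
  classical
  let m := IsLocalRing.maximalIdeal A
  have hinj : Function.Injective (algebraMap A K) := IsFractionRing.injective A K
  have hm : m ≠ ⊥ := fun h => hA (IsLocalRing.isField_iff_maximalIdeal_eq.mpr h)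
  -- Lowering the exponent step by step replaces `g` by a multiple `y ∉ A` with `m y ⊆ A`.
  obtain ⟨y, hy, hmy⟩ : ∃ y : K, y ∉ (algebraMap A K).range ∧
      ∀ x ∈ m, x • y ∈ (algebraMap A K).range := by
    induction n generalizing g with
    | zero => exact absurd (by simpa using hn 1 (by simp)) hg
    | succ n ih =>
      by_cases h : ∀ x ∈ m ^ n, x • g ∈ (algebraMap A K).range
      · exact ih g hg h
      · push Not at h
        obtain ⟨x, hx, hxg⟩ := h
        refine ⟨x • g, hxg, fun z hz => ?_⟩
        rw [← mul_smul]
        exact hn _ (by rw [pow_succ']; exact Ideal.mul_mem_mul hz hx)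
  refine ((IsDiscreteValuationRing.TFAE A hA).out 0 4).mpr ?_
  -- If `m y ⊆ m`, then `y` is integral over `A`, which is impossible by normality. Otherwise `x y`
  -- is a unit for some `x ∈ m`, and `x` generates `m`.
  by_cases h : ∀ x ∈ m, ∃ z ∈ m, algebraMap A K z = x • y
  · refine absurd (IsIntegrallyClosed.isIntegral_iff.mp ?_) hy
    refine isIntegral_of_smul_mem_submodule (M := K)
      (Submodule.map (Algebra.linearMap A K) m) ?_ ?_ y ?_
    · obtain ⟨x, hx, hx0⟩ := Submodule.exists_mem_ne_zero_of_ne_bot hm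
      exact fun h0 => hx0 <| hinj <| (Submodule.mem_bot A).mp
        (h0 ▸ Submodule.mem_map_of_mem (f := Algebra.linearMap A K) hx) |>.trans (map_zero _).symm
    · exact (IsNoetherian.noetherian m).map _
    · rintro _ ⟨x, hx, rfl⟩
      obtain ⟨z, hz, hzx⟩ := h x hx
      exact ⟨z, hz, by simpa [Algebra.smul_def, mul_comm] using hzx⟩
  · push Not at h
    obtain ⟨x, hx, hxz⟩ := h
    obtain ⟨z, hz⟩ := hmy x hx
    have hzu : IsUnit z := by
      by_contra hu
      exact hxz z ((IsLocalRing.mem_maximalIdeal z).mpr hu) hz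
    obtain ⟨u, rfl⟩ := hzu
    refine ⟨x, le_antisymm (fun w hw => ?_) ?_⟩
    · obtain ⟨v, hv⟩ := hmy w hw
      rw [Submodule.mem_span_singleton]
      refine ⟨v * ↑u⁻¹, hinj ?_⟩
      have h1 : algebraMap A K u * algebraMap A K ↑u⁻¹ = 1 := by
        rw [← map_mul]; simp
      simp only [Algebra.smul_def] at hz hv
      simp only [smul_eq_mul, map_mul, hv]
      linear_combination (algebraMap A K w) * h1 - algebraMap A K w * algebraMap A K ↑u⁻¹ * hz
    · rw [Submodule.span_le]
      exact Set.singleton_subset_iff.mpr hx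

end

/-! ### Normal schemes: a function that first fails to be regular at `x` forces codimension one. -/

section
open AlgebraicGeometry CategoryTheory TopologicalSpace TensorProduct nonZeroDivisors

namespace AlgebraicGeometry.Scheme

theorem isIntegrallyClosed_stalk_of_smooth {X : Scheme.{0}} [IsIntegral X] {k : Type} [Field k]
    (f : X ⟶ Spec (.of k)) [Smooth f] (x : X) : IsIntegrallyClosed (X.presheaf.stalk x) := by
  obtain ⟨_, ⟨V, hV, rfl⟩, hxV, -⟩ :=
    X.isBasis_affineOpens.exists_subset_of_mem_open (Set.mem_univ x) isOpen_univ
  have := hV.isOpenImmersion_fromSpec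
  have hs : Smooth (hV.fromSpec ≫ f) := inferInstance
  obtain ⟨φ, hφ⟩ := Spec.map_surjective (hV.fromSpec ≫ f)
  rw [← hφ, HasRingHomProperty.Spec_iff (P := @Smooth)] at hs
  have : Nonempty V := ⟨⟨x, hxV⟩⟩
  algebraize [φ.hom]
  have : Algebra.Smooth k Γ(X, V) := hs
  have : IsIntegrallyClosed Γ(X, V) := Algebra.Smooth.isIntegrallyClosed k _
  let _ := X.presheaf.algebra_section_stalk (⟨x, hxV⟩ : V)
  have := hV.isLocalization_stalk ⟨x, hxV⟩
  exact isIntegrallyClosed_of_isLocalization (R := Γ(X, V)) _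
    (hV.primeIdealOf ⟨x, hxV⟩).asIdeal.primeCompl (Ideal.primeCompl_le_nonZeroDivisors _)

theorem mem_basicOpen_fromSpecStalk_iff {X : Scheme.{0}} {V : X.Opens} (hV : IsAffineOpen V)
    {x : X} (hx : x ∈ V) (f : Γ(X, V)) (q : Spec (X.presheaf.stalk x)) :
    X.fromSpecStalk x q ∈ X.basicOpen f ↔ X.presheaf.germ V x hx f ∉ q.asIdeal := by
  rw [← hV.fromSpecStalk_eq_fromSpecStalk hx, IsAffineOpen.fromSpecStalk, Scheme.Hom.comp_apply]
  have := hV.fromSpec_preimage_basicOpen f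
  change _ ∈ hV.fromSpec ⁻¹ᵁ X.basicOpen f ↔ _
  rw [this]
  rfl

theorem germToFunctionField_map {X : Scheme.{0}} [IsIntegral X] {U V : X.Opens} (i : U ≤ V)
    [Nonempty U] [Nonempty V] (f : Γ(X, V)) :
    X.germToFunctionField U (X.presheaf.map (homOfLE i).op f) = X.germToFunctionField V f :=
  X.presheaf.germ_res_apply (homOfLE i) _ _ f

theorem exists_pow_germ_smul_eq {X : Scheme.{0}} [IsIntegral X] {V W : X.Opens}
    (hV : IsAffineOpen V) [Nonempty V] [Nonempty W] (s : Γ(X, W)) {y : X} (hyV : y ∈ V)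
    (hyW : y ∈ W) : ∃ (f r : Γ(X, V)), y ∈ X.basicOpen f ∧
      X.germToFunctionField V f * X.germToFunctionField W s = X.germToFunctionField V r := by
  obtain ⟨f, hfW, hyf⟩ := hV.exists_basicOpen_le ⟨y, hyW⟩ hyV
  have := hV.isLocalization_basicOpen f
  obtain ⟨n, r, hr⟩ := IsLocalization.Away.surj f (X.presheaf.map (homOfLE hfW).op s)
  have : Nonempty (X.basicOpen f) := ⟨⟨y, hyf⟩⟩
  have halg (g : Γ(X, V)) : X.germToFunctionField (X.basicOpen f)
      (algebraMap Γ(X, V) Γ(X, X.basicOpen f) g) = X.germToFunctionField V g :=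
    germToFunctionField_map (X.basicOpen_le f) g
  have h := congr(X.germToFunctionField (X.basicOpen f) $hr)
  rw [halg, map_mul, map_pow, halg, germToFunctionField_map] at h
  -- The exponent `n + 1` is positive even for `n = 0`, so `f ^ (n + 1)` has the same basic open set
  -- as `f`.
  refine ⟨f ^ (n + 1), f * r, ?_, ?_⟩
  · rwa [X.basicOpen_pow f n.succ_pos]
  · rw [map_mul, ← h, map_pow]
    ring

/-- Let `g` be a rational function that is regular at all proper generizations of a point `x` of a
normal locally noetherian integral scheme. If `g` is not regular at `x`, then the local ring at `x`
is a discrete valuation ring. -/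
theorem isDiscreteValuationRing_stalk {X : Scheme.{0}} [IsIntegral X] [IsLocallyNoetherian X]
    (x : X) [IsIntegrallyClosed (X.presheaf.stalk x)] (W : X.Opens) [Nonempty W] (s : Γ(X, W))
    (hW : ∀ y, y ⤳ x → y ≠ x → y ∈ W)
    (hs : X.germToFunctionField W s ∉ (algebraMap (X.presheaf.stalk x) X.functionField).range) :
    IsDiscreteValuationRing (X.presheaf.stalk x) := by
  let A := X.presheaf.stalk x
  let K := X.functionField
  let g : K := X.germToFunctionField W s
  -- `J` is the ideal of denominators of `g`.
  let J : Ideal A := (LinearMap.range (Algebra.linearMap A K)).comap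
    (LinearMap.toSpanSingleton A K g)
  have hJ (r : A) : r ∈ J ↔ r • g ∈ (algebraMap A K).range := Iff.rfl
  obtain ⟨_, ⟨V, hV, rfl⟩, hxV, -⟩ :=
    X.isBasis_affineOpens.exists_subset_of_mem_open (Set.mem_univ x) isOpen_univ
  have : Nonempty V := ⟨⟨x, hxV⟩⟩
  -- A prime `q ⊇ J` other than the maximal ideal would be a proper generization `y` of `x`. As `g`
  -- is regular at `y`, it has a denominator outside `q`, which contradicts `J ≤ q`.
  have hle : IsLocalRing.maximalIdeal A ≤ J.radical := by
    rw [Ideal.radical_eq_sInf]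
    refine le_sInf fun q ⟨hJq, hq⟩ => ?_
    by_contra hne
    let y := X.fromSpecStalk x ⟨q, hq⟩
    have hy : y ⤳ x := by
      have : y ∈ Set.range (X.fromSpecStalk x) := ⟨_, rfl⟩
      rwa [range_fromSpecStalk] at this
    have hyx : y ≠ x := by
      intro h
      have h' := h.trans (fromSpecStalk_closedPoint (x := x)).symm
      have := (X.fromSpecStalk x).isEmbedding.injective h'
      exact hne (congr(($this).asIdeal)).ge
    obtain ⟨f, r, hyf, hfr⟩ := exists_pow_germ_smul_eq hV s (hy.mem_open V.2 hxV) (hW y hy hyx)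
    refine (mem_basicOpen_fromSpecStalk_iff hV hxV f _).mp hyf
      (hJq ((hJ _).mpr ⟨X.presheaf.germ V x hxV r, ?_⟩))
    rw [Algebra.smul_def, algebraMap_germ_eq_germToFunctionField,
      algebraMap_germ_eq_germToFunctionField, ← hfr]
  obtain ⟨n, hn⟩ := Ideal.exists_pow_le_of_le_radical_of_fg hle (IsNoetherian.noetherian _)
  refine IsDiscreteValuationRing.of_forall_maximalIdeal_pow_mul_mem (K := K) (fun hA => ?_) g hs n
    fun r hr => (hJ r).mp (hn hr)
  exact hs <| (hA.localization_map_bijective (M := (X.presheaf.stalk x)⁰)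
    (Rₘ := X.functionField) (by simp)).2 _

end AlgebraicGeometry.Scheme

end

/-! ### Points where all functions of an affine open set are regular; separatedness and
noetherianity of `X`. -/

section
open AlgebraicGeometry CategoryTheory TopologicalSpace TensorProduct
open MonoidalCategory CartesianMonoidalCategory MonObj

theorem Algebra.FiniteType.of_gradeZero {R A M : Type*} [CommRing R] [CommRing A] [Algebra R A]
    [DecidableEq M] [AddCommMonoid M] [IsRightCancelAdd M] (𝒜 : M → Submodule R A)
    [GradedAlgebra 𝒜] [Algebra.FiniteType R A] : Algebra.FiniteType (𝒜 0) A :=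
  have : IsScalarTower R (𝒜 0) A := .of_algebraMap_eq fun _ => rfl
  .of_restrictScalars_finiteType R _ _

namespace AlgebraicGeometry.Scheme

theorem SpecMap_germToFunctionField_comp {X : Scheme.{0}} [IsIntegral X] {R : CommRingCat.{0}}
    (i : Spec R ⟶ X) [IsOpenImmersion i] [Nonempty (i ''ᵁ ⊤)] :
    Spec.map ((Scheme.ΓSpecIso R).inv ≫ (i.appIso ⊤).inv ≫ X.germToFunctionField (i ''ᵁ ⊤)) ≫ i =
      X.fromSpecStalk (genericPoint X) := by
  have hU : IsAffineOpen (i ''ᵁ ⊤) := (isAffineOpen_top _).image_of_isOpenImmersion _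
  have hgen : genericPoint X ∈ i ''ᵁ ⊤ :=
    ((genericPoint_spec X).mem_open_set_iff (i ''ᵁ ⊤).isOpen).mpr
      (by simpa using ‹Nonempty (i ''ᵁ ⊤)›)
  rw [← hU.fromSpecStalk_eq_fromSpecStalk hgen, IsAffineOpen.fromSpecStalk]
  have h := IsAffineOpen.SpecMap_appLE_fromSpec i hU (isAffineOpen_top (Spec R))
    (i.preimage_image_eq ⊤).ge
  have h2 : i.appLE (i ''ᵁ ⊤) ⊤ (i.preimage_image_eq ⊤).ge = (i.appIso ⊤).hom := by
    rw [Scheme.Hom.appIso_hom']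
  rw [h2, IsAffineOpen.fromSpec_top, Scheme.isoSpec_Spec_inv] at h
  have h3 : hU.fromSpec = Spec.map (i.appIso ⊤).inv ≫ Spec.map (ΓSpecIso R).inv ≫ i := by
    rw [← h, ← Spec.map_comp_assoc, Iso.hom_inv_id, Spec.map_id, Category.id_comp]
  rw [h3]
  simp only [Spec.map_comp, Category.assoc]

/-- The map `Spec φ ≫ i` and the canonical map from the spectrum of the local ring to `X` agree at
the generic point, hence everywhere by separatedness. The closed point goes to `x` under the second
map and into the range of `i` under the first. -/
theorem mem_range_of_regular {X : Scheme.{0}} [IsIntegral X] [X.IsSeparated] {R : CommRingCat.{0}}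
    (i : Spec R ⟶ X) [IsOpenImmersion i] [Nonempty (i ''ᵁ ⊤)] {x : X} (φ : R ⟶ X.presheaf.stalk x)
    (hφ : φ ≫ X.presheaf.stalkSpecializes ((genericPoint_spec X).specializes trivial) =
      (Scheme.ΓSpecIso R).inv ≫ (i.appIso ⊤).inv ≫ X.germToFunctionField (i ''ᵁ ⊤)) :
    x ∈ Set.range i := by
  let g : Spec X.functionField ⟶ Spec (X.presheaf.stalk x) :=
    Spec.map (X.presheaf.stalkSpecializes ((genericPoint_spec X).specializes trivial))
  have : IsDominant g := by
    refine ⟨(PrimeSpectrum.denseRange_comap_iff_ker_le_nilRadical _).mpr ?_⟩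
    have := IsFractionRing.injective (X.presheaf.stalk x) X.functionField
    exact (RingHom.ker_eq_bot_iff_eq_zero _).mpr
      (fun r hr => this (hr.trans (map_zero _).symm)) |>.le.trans bot_le
  have h : Spec.map φ ≫ i = X.fromSpecStalk x := by
    refine ext_of_isDominant g ?_
    rw [← Spec.map_comp_assoc, hφ, SpecMap_germToFunctionField_comp]
    exact (Scheme.SpecMap_stalkSpecializes_fromSpecStalk _).symm
  refine ⟨Spec.map φ (IsLocalRing.closedPoint (X.presheaf.stalk x)), ?_⟩
  exact congr($h (IsLocalRing.closedPoint (X.presheaf.stalk x))).trans fromSpecStalk_closedPoint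

end AlgebraicGeometry.Scheme

theorem AlgebraicGeometry.compactSpace_proj_of_finiteType {R A : Type} [CommRing R] [CommRing A]
    [Algebra R A] (𝒜 : ℕ → Submodule R A) [GradedAlgebra 𝒜] [Algebra.FiniteType R A] :
    CompactSpace (Proj 𝒜) :=
  have := Algebra.FiniteType.of_gradeZero 𝒜
  QuasiCompact.compactSpace_of_compactSpace (Proj.toSpecZero 𝒜)

namespace AxB
namespace CoordRing

theorem b_sub_ne_zero (c : ℚ) : b - algebraMap ℚ CoordRing c ≠ 0 := by
  intro h
  have := congr(lift (1 : ℚ) (c + 1) isUnit_one $h)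
  simp at this

theorem ringHom_ext {B : Type*} [Ring B] {f g : CoordRing →+* B}
    (ha : f a = g a) (hb : f b = g b) : f = g := by
  apply IsLocalization.ringHom_ext (Submonoid.powers (MvPolynomial.X 0 : MvPolynomial (Fin 2) ℚ))
  apply MvPolynomial.ringHom_ext
  · intro r
    exact congr($(RingHom.ext_rat
      ((f.comp (algebraMap (MvPolynomial (Fin 2) ℚ) CoordRing)).comp MvPolynomial.C)
      ((g.comp (algebraMap (MvPolynomial (Fin 2) ℚ) CoordRing)).comp MvPolynomial.C)) r)
  · intro i
    fin_cases i
    · exact ha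
    · exact hb

end CoordRing

section Projective

attribute [local instance] MvPolynomial.gradedAlgebra

instance (n : ℕ) : Scheme.IsSeparated (ProjSpace n).left :=
  inferInstanceAs (Scheme.IsSeparated (Proj (MvPolynomial.homogeneousSubmodule (Fin (n + 1)) ℚ)))

instance (n : ℕ) : CompactSpace (ProjSpace n).left :=
  compactSpace_proj_of_finiteType (MvPolynomial.homogeneousSubmodule (Fin (n + 1)) ℚ)

end Projective

namespace Compactification
variable (C : Compactification)

instance : C.X.left.IsSeparated := by
  obtain ⟨n, i, hi⟩ := C.projective
  have : IsSeparated i.left := inferInstance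
  rw [Scheme.isSeparated_iff, ← Limits.terminal.comp_from i.left]
  infer_instance

instance : CompactSpace C.X.left := by
  obtain ⟨n, i, hi⟩ := C.projective
  exact QuasiCompact.compactSpace_of_compactSpace i.left

instance : IsNoetherian C.X.left where

theorem ofG_injective : Function.Injective C.ofG := by
  have h1 : Function.Injective (C.X.left.germToFunctionField (C.incl.left ''ᵁ ⊤)) :=
    C.X.left.germToFunctionField_injective _
  have h2 : Function.Injective ((Scheme.ΓSpecIso (.of CoordRing)).inv ≫
      (C.incl.left.appIso ⊤).inv) := by
    have h (f : CommRingCat.of CoordRing ⟶ Γ(G.left, ⊤)) [IsIso f] :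
        Function.Injective (f ≫ (C.incl.left.appIso ⊤).inv) :=
      (ConcreteCategory.bijective_of_isIso _).1
    exact @h (Scheme.ΓSpecIso (.of CoordRing)).inv (Iso.isIso_inv _)
  exact h1.comp h2

instance : CharZero C.FunField :=
  charZero_of_injective_ringHom (C.ofG.comp (algebraMap ℚ CoordRing)).injective

theorem ofG_algebraMap (c : ℚ) : C.ofG (algebraMap ℚ CoordRing c) = c :=
  eq_ratCast (C.ofG.comp (algebraMap ℚ CoordRing)) c

theorem b_sub_ne_zero (c : ℚ) : C.b - (c : C.FunField) ≠ 0 := by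
  rw [b, ← C.ofG_algebraMap, ← map_sub]
  exact (map_ne_zero_iff _ C.ofG_injective).mpr (CoordRing.b_sub_ne_zero c)

theorem a_ne_zero : C.a ≠ 0 :=
  (map_ne_zero_iff _ C.ofG_injective).mpr CoordRing.isUnit_a.ne_zero

theorem exists_germ_eq_ofG (g : CoordRing) : ∃ s,
    C.X.left.germToFunctionField (C.incl.left ''ᵁ ⊤) s = C.ofG g :=
  ⟨((Scheme.ΓSpecIso (.of CoordRing)).inv ≫ (C.incl.left.appIso ⊤).inv).hom g, rfl⟩

/-- A point of `X` at which all regular functions on `G` are regular lies on `G`. -/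
theorem mem_range_incl {x : C.X.left} (φ : CoordRing →+* C.X.left.presheaf.stalk x)
    (hφ : ∀ r, algebraMap (C.X.left.presheaf.stalk x) C.X.left.functionField (φ r) = C.ofG r) :
    x ∈ Set.range C.incl.left :=
  let i : Spec (.of CoordRing) ⟶ C.X.left := C.incl.left
  have : IsOpenImmersion i := C.isOpenImmersion
  have : Nonempty (i ''ᵁ ⊤) := inferInstanceAs (Nonempty (C.incl.left ''ᵁ ⊤ : C.X.left.Opens))
  Scheme.mem_range_of_regular i (CommRingCat.ofHom φ) (CommRingCat.hom_ext (RingHom.ext hφ))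

end Compactification
end AxB

end

/-! ### Orders along `D_j`, and the local ring at its generic point. -/

section
open AlgebraicGeometry CategoryTheory TopologicalSpace TensorProduct
open MonoidalCategory CartesianMonoidalCategory MonObj

namespace AlgebraicGeometry.Scheme

variable {X : Scheme.{0}} [IsIntegral X] {x : X} [IsDiscreteValuationRing (X.presheaf.stalk x)]

theorem coheight_eq_one_of_isDiscreteValuationRing : Order.coheight x = 1 := by
  have h : ringKrullDim (X.presheaf.stalk x) = 1 := IsDiscreteValuationRing.ringKrullDim_eq_one _
  rw [ringKrullDim_stalk_eq_coheight] at h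
  exact_mod_cast h

variable [IsLocallyNoetherian X]

theorem ord_zpow {f : X.functionField} (hf : f ≠ 0) (n : ℤ) : ord (f ^ n) x = n * ord f x := by
  have h := coheight_eq_one_of_isDiscreteValuationRing (x := x)
  rw [ord_eq_iff h (zpow_ne_zero _ hf), map_zpow₀, (ord_eq_iff h hf).mp rfl]
  rw [← WithZero.coe_zpow, ← ofAdd_zsmul]
  rfl

theorem exists_algebraMap_eq_of_ord_eq_zero {f : X.functionField} (hf : f ≠ 0)
    (h : ord f x = 0) : ∃ u : (X.presheaf.stalk x)ˣ,
      algebraMap (X.presheaf.stalk x) X.functionField u = f := by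
  have hx := coheight_eq_one_of_isDiscreteValuationRing (x := x)
  rw [ord_eq_iff hx hf] at h
  have h' : f ∈ MonoidHom.mker (Ring.ordFrac (K := X.functionField) (X.presheaf.stalk x)) := h
  rw [Ring.mker_ordFrac_eq_isUnitSubmonoid] at h'
  obtain ⟨u, hu, rfl⟩ := h'
  exact ⟨hu.unit, rfl⟩

theorem ord_algebraMap_pos {r : X.presheaf.stalk x} (hr : r ≠ 0)
    (hr' : r ∈ IsLocalRing.maximalIdeal (X.presheaf.stalk x)) :
    0 < ord (algebraMap (X.presheaf.stalk x) X.functionField r) x := by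
  have hx := coheight_eq_one_of_isDiscreteValuationRing (x := x)
  have hf := (map_ne_zero_iff _ (IsFractionRing.injective (X.presheaf.stalk x)
    X.functionField)).mpr hr
  have h0 : 0 ≤ ord (algebraMap (X.presheaf.stalk x) X.functionField r) x := by
    rw [le_ord_iff hx hf]
    exact Ring.ordFrac_ge_one_of_ne_zero hr
  refine h0.lt_of_ne' fun h => ?_
  obtain ⟨u, hu⟩ := exists_algebraMap_eq_of_ord_eq_zero hf h
  have := IsFractionRing.injective (X.presheaf.stalk x) X.functionField hu
  exact (IsLocalRing.mem_maximalIdeal r).mp hr' (this ▸ u.isUnit)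

end AlgebraicGeometry.Scheme

namespace AxB.Compactification

namespace J
variable {C : Compactification} (j : C.J)

theorem isGenericPoint_point : IsGenericPoint j.point (j.carrier : Set C.X.left) := by
  have := j.isIrreducible.isGenericPoint_genericPoint_closure
  rwa [j.carrier.isClosed.closure_eq] at this

theorem point_mem_boundary : j.point ∈ C.boundary :=
  j.maximal.1.2 j.isGenericPoint_point.mem

theorem isClosed_boundary : IsClosed C.boundary :=
  C.incl.left.isOpenEmbedding.isOpen_range.isClosed_compl

/-- The closure of `y` is an irreducible subset of the boundary containing `D_j`, so it equals `D_j`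
by maximality. Thus all proper generizations of the generic point of `D_j` lie in `G`. -/
theorem eq_point_of_specializes {y : C.X.left} (h : y ⤳ j.point) (hy : y ∈ C.boundary) :
    y = j.point := by
  have h1 : closure {y} ⊆ C.boundary := isClosed_boundary.closure_subset_iff.mpr (by simpa)
  have h2 : (j.carrier : Set C.X.left) ⊆ closure {y} := by
    rw [← j.isGenericPoint_point.def]
    exact closure_minimal (by simpa using h.mem_closure) isClosed_closure
  have h3 := j.maximal.2 ⟨isIrreducible_singleton.closure, h1⟩ h2
  exact IsGenericPoint.eq (S := closure {y}) rfl
    (by rw [IsGenericPoint, j.isGenericPoint_point.def]; exact h2.antisymm h3)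

theorem point_mem_of_meets {U : C.X.left.Opens}
    (h : ((U : Set C.X.left) ∩ j.carrier).Nonempty) : j.point ∈ U := by
  rw [Set.inter_comm] at h
  exact (j.isGenericPoint_point.mem_open_set_iff U.isOpen).mpr h

instance : IsIntegrallyClosed (C.X.left.presheaf.stalk j.point) :=
  Scheme.isIntegrallyClosed_stalk_of_smooth C.X.hom _

variable (C) in
theorem exists_ringHom_rat (x : C.X.left) : Nonempty (ℚ →+* C.X.left.presheaf.stalk x) :=
  ⟨((Scheme.ΓSpecIso (.of ℚ)).inv ≫ C.X.hom.appTop ≫ C.X.left.presheaf.germ ⊤ x trivial).hom⟩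

/-- If `a`, `a⁻¹` and `b` were all regular at the generic point of `D_j`, so would be every function
on `G`, and `mem_range_incl` would place that point in `G`. -/
theorem exists_notMem_range : ∃ r : CoordRing, (r = CoordRing.a ∨ r * CoordRing.a = 1 ∨
    r = CoordRing.b) ∧
    C.ofG r ∉ (algebraMap (C.X.left.presheaf.stalk j.point) C.X.left.functionField).range := by
  by_contra! h
  let A := C.X.left.presheaf.stalk j.point
  have hinj := IsFractionRing.injective A C.X.left.functionField
  obtain ⟨u, hu⟩ := h CoordRing.a (.inl rfl)
  obtain ⟨v, hv⟩ := h CoordRing.b (.inr (.inr rfl))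
  obtain ⟨w, hw⟩ := h (Ring.inverse CoordRing.a)
    (.inr (.inl (Ring.inverse_mul_cancel _ CoordRing.isUnit_a)))
  have hwu : u * w = 1 := hinj (by
    rw [map_mul, hu, hw, ← map_mul, CoordRing.a_mul_inverse, map_one, map_one])
  obtain ⟨ψ⟩ := exists_ringHom_rat C j.point
  let _ : Algebra ℚ A := ψ.toAlgebra
  let φ : CoordRing →+* A := CoordRing.lift u v (.of_mul_eq_one w hwu)
  have hφ : (algebraMap A C.X.left.functionField).comp φ = C.ofG :=
    CoordRing.ringHom_ext (by simpa [φ] using hu) (by simpa [φ] using hv)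
  exact j.point_mem_boundary (C.mem_range_incl φ (RingHom.congr_fun hφ))

instance : IsDiscreteValuationRing (C.X.left.presheaf.stalk j.point) := by
  obtain ⟨r, -, hr⟩ := j.exists_notMem_range
  obtain ⟨s, hs⟩ := C.exists_germ_eq_ofG r
  refine Scheme.isDiscreteValuationRing_stalk j.point _ s (fun y hy hne => ?_) (hs ▸ hr)
  by_contra hyW
  refine hne (j.eq_point_of_specializes hy fun ⟨z, hz⟩ => hyW ⟨z, trivial, hz⟩)

theorem exists_algebraMap_eq {f : C.FunField} (hf : f ≠ 0) (h : j.ord f = 0) :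
    ∃ u : (C.X.left.presheaf.stalk j.point)ˣ,
      algebraMap (C.X.left.presheaf.stalk j.point) C.X.left.functionField u = f :=
  Scheme.exists_algebraMap_eq_of_ord_eq_zero hf h

theorem nonempty_unitNear {F : C.FunField} (u : (C.X.left.presheaf.stalk j.point)ˣ)
    (hu : algebraMap (C.X.left.presheaf.stalk j.point) C.X.left.functionField u = F) :
    Nonempty (j.UnitNear F) := by
  obtain ⟨V, hV, f, hf⟩ := C.X.left.presheaf.exists_germ_eq
    (u : C.X.left.presheaf.stalk j.point)
  have hmem : j.point ∈ C.X.left.basicOpen f := by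
    rw [Scheme.mem_basicOpen _ _ _ hV, hf]
    exact u.isUnit
  have : Nonempty (C.X.left.basicOpen f) := ⟨⟨_, hmem⟩⟩
  exact ⟨{
    U := C.X.left.basicOpen f
    dense := (C.X.left.basicOpen f).isOpen.dense ⟨_, hmem⟩
    meets := ⟨_, hmem, j.isGenericPoint_point.mem⟩
    f := C.X.left.presheaf.map (homOfLE (C.X.left.basicOpen_le f)).op f
    isUnit := RingedSpace.isUnit_res_basicOpen _ f
    eq := by
      rw [← Scheme.algebraMap_germ_eq_germToFunctionField _ hmem, ← hu, ← hf]
      congr 1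
      exact C.X.left.presheaf.germ_res_apply _ _ _ f }⟩

/-- If neither `a` nor `b - c` has a zero or a pole along `D_j` then `D_j` meets `G`. -/
theorem ord_a_ne_zero (c : ℚ) (h : j.ord (C.b - (c : C.FunField)) = 0) : j.ord C.a ≠ 0 := by
  intro ha
  obtain ⟨u, hu⟩ := j.exists_algebraMap_eq C.a_ne_zero ha
  obtain ⟨v, hv⟩ := j.exists_algebraMap_eq (C.b_sub_ne_zero c) h
  obtain ⟨r, hr, hr'⟩ := j.exists_notMem_range
  refine hr' ?_
  obtain rfl | hr | rfl := hr
  · exact ⟨u, hu⟩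
  · refine ⟨(u⁻¹ : (C.X.left.presheaf.stalk j.point)ˣ), ?_⟩
    have h1 := congr(C.ofG $hr)
    rw [map_mul, map_one] at h1
    rw [eq_inv_of_mul_eq_one_left h1]
    refine eq_inv_of_mul_eq_one_left ?_
    change _ * C.a = _
    rw [← hu, ← map_mul]
    simp
  · obtain ⟨ψ⟩ := exists_ringHom_rat C j.point
    refine ⟨v + ψ c, ?_⟩
    rw [map_add, hv, show algebraMap (C.X.left.presheaf.stalk j.point) C.X.left.functionField (ψ c)
      = c from eq_ratCast ((algebraMap _ _).comp ψ) c, sub_add_cancel]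
    rfl

end J
end AxB.Compactification

end

/-! ### Constant maps to `ℙ¹` and algebraic values. -/

section
open AlgebraicGeometry CategoryTheory TopologicalSpace TensorProduct
open MonoidalCategory CartesianMonoidalCategory MonObj

namespace AlgebraicGeometry.Scheme

/-- By the Nullstellensatz, a closed point of an affine chart has residue field finite over `k`; `h`
is the minimal polynomial of the value of `f` there. -/
theorem exists_notMem_basicOpen_eval₂ {T : Scheme.{0}} [Nonempty T] {k : Type} [Field k]
    (π : T ⟶ Spec (.of k)) [LocallyOfFiniteType π] (χ : k →+* Γ(T, ⊤))
    (hχ : χ = ((ΓSpecIso (.of k)).inv ≫ π.appTop).hom) (f : Γ(T, ⊤)) :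
    ∃ h : Polynomial k, h ≠ 0 ∧ ∃ t : T, t ∉ T.basicOpen (h.eval₂ χ f) := by
  obtain ⟨x⟩ := ‹Nonempty T›
  obtain ⟨_, ⟨V, hV, rfl⟩, hxV, -⟩ :=
    T.isBasis_affineOpens.exists_subset_of_mem_open (Set.mem_univ x) isOpen_univ
  let ψ : k →+* Γ(T, V) := (T.presheaf.map (homOfLE (le_top : V ≤ ⊤)).op).hom.comp χ
  have hψ : ψ.FiniteType := by
    subst hχ
    have h1 : (π.appLE ⊤ V le_top).hom.FiniteType :=
      π.finiteType_appLE (isAffineOpen_top _) hV _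
    exact h1.comp (.of_surjective _ (ConcreteCategory.bijective_of_isIso (ΓSpecIso (.of k)).inv).2)
  have : Nontrivial Γ(T, V) := (T.presheaf.germ V x hxV).hom.domain_nontrivial
  obtain ⟨m, hm⟩ := Ideal.exists_maximal Γ(T, V)
  let := Ideal.Quotient.field m
  algebraize [ψ]
  have := finite_of_finite_type_of_isJacobsonRing k (Γ(T, V) ⧸ m)
  let r : Γ(T, V) := T.presheaf.map (homOfLE le_top).op f
  have hr : _root_.IsIntegral k (Ideal.Quotient.mk m r) := .of_finite k _
  refine ⟨minpoly k (Ideal.Quotient.mk m r), minpoly.ne_zero hr, hV.fromSpec ⟨m, hm.isPrime⟩, ?_⟩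
  intro hmem
  set h := minpoly k (Ideal.Quotient.mk m r)
  have hV' : hV.fromSpec ⟨m, hm.isPrime⟩ ∈ V := by
    have : hV.fromSpec ⟨m, hm.isPrime⟩ ∈ Set.range hV.fromSpec := ⟨_, rfl⟩
    rwa [hV.range_fromSpec] at this
  have h1 : hV.fromSpec ⟨m, hm.isPrime⟩ ∈ T.basicOpen (h.eval₂ ψ r) := by
    have h2 : h.eval₂ ψ r = T.presheaf.map (homOfLE (le_top : V ≤ ⊤)).op
        (h.eval₂ χ f) :=
      (Polynomial.hom_eval₂ h χ (T.presheaf.map (homOfLE (le_top : V ≤ ⊤)).op).hom f).symm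
    rw [h2, Scheme.basicOpen_res]
    exact ⟨hV', hmem⟩
  have h3 : (⟨m, hm.isPrime⟩ : Spec Γ(T, V)) ∈ hV.fromSpec ⁻¹ᵁ T.basicOpen (h.eval₂ ψ r) := h1
  rw [hV.fromSpec_preimage_basicOpen] at h3
  apply h3
  rw [← Ideal.Quotient.eq_zero_iff_mem]
  have h4 := minpoly.aeval k (Ideal.Quotient.mk m r)
  rw [Polynomial.aeval_def] at h4
  rw [Polynomial.hom_eval₂]
  exact h4

end AlgebraicGeometry.Scheme

namespace AxB

section Projective
attribute [local instance] MvPolynomial.gradedAlgebra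

theorem exists_preimage_toP1_eq {T : Scheme.{0}} (π : T ⟶ Spec (.of ℚ)) (χ : ℚ →+* Γ(T, ⊤))
    (f : Γ(T, ⊤)) (h : Polynomial ℚ) : ∃ V : (ProjSpace 1).left.Opens, toP1 π f ⁻¹ᵁ V =
      T.basicOpen (h.eval₂ χ f) := by
  -- Homogenizing in degree `natDegree + 1` keeps the degree positive for constant `h` as well; the
  -- extra factor is a power of the coordinate sent to `1`.
  refine ⟨Proj.basicOpen (MvPolynomial.homogeneousSubmodule (Fin 2) ℚ)
    (h.homogenize (h.natDegree + 1)), ?_⟩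
  refine (Proj.fromOfGlobalSections_preimage_basicOpen _ _ _ h.natDegree.succ_pos
    (Polynomial.isHomogeneous_homogenize h)).trans ?_
  congr 1
  rw [RingHom.ext_rat χ ((Scheme.ΓSpecIso (.of ℚ)).inv ≫ π.appTop).hom]
  exact Polynomial.eval₂_homogenize_of_eq_one (Nat.le_succ _) _ _ (by simp)

/-- The nonvanishing locus of `h(f)` is the preimage of an open subset of `ℙ¹`, so along a constant
map `h(f)` vanishes everywhere as soon as it vanishes at one point. -/
theorem exists_notMem_basicOpen_of_constant {T W : Scheme.{0}} [Nonempty W]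
    (π : T ⟶ Spec (.of ℚ)) [LocallyOfFiniteType π] (χ : ℚ →+* Γ(T, ⊤)) (f : Γ(T, ⊤)) (i : W ⟶ T)
    [LocallyOfFiniteType i] (z : (ProjSpace 1).left) (hz : ∀ w, (i ≫ toP1 π f) w = z) :
    ∃ h : Polynomial ℚ, h ≠ 0 ∧ ∀ w, i w ∉
      T.basicOpen (h.eval₂ χ f) := by
  obtain ⟨h, h0, w₀, hw₀⟩ := Scheme.exists_notMem_basicOpen_eval₂ (i ≫ π)
    (i.appTop.hom.comp χ) (RingHom.ext_rat _ _) (i.appTop f)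
  refine ⟨h, h0, fun w hw => hw₀ ?_⟩
  obtain ⟨V, hV⟩ := exists_preimage_toP1_eq π χ f h
  have key (w : W) : i w ∈ T.basicOpen
      (h.eval₂ χ f) ↔ z ∈ V := by
    rw [← hV, ← hz w]
    rfl
  have h1 : w₀ ∈ i ⁻¹ᵁ T.basicOpen
      (h.eval₂ χ f) := (key w₀).mpr ((key w).mp hw)
  rw [Scheme.preimage_basicOpen] at h1
  convert! h1 using 2
  exact (Polynomial.hom_eval₂ h χ i.appTop.hom f).symm

end Projective

namespace Compactification.J
variable {C : Compactification} (j : C.J)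

theorem emb_genericPoint : j.emb (genericPoint j.D) = j.point := by
  have h := (genericPoint_spec j.D).image j.emb.continuous
  rw [Set.image_univ, range_emb, j.carrier.isClosed.closure_eq] at h
  exact h.eq j.isGenericPoint_point

instance : IsClosedImmersion j.emb :=
  inferInstanceAs (IsClosedImmersion
    (Scheme.IdealSheafData.vanishingIdeal j.carrier).subschemeι)

instance : LocallyOfFiniteType j.π := by
  unfold π
  infer_instance

theorem exists_eval₂_mem_maximalIdeal {F : C.FunField} (M : j.UnitNear F)
    (hM : IsConstant M.ratMap) (u : C.X.left.presheaf.stalk j.point)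
    (hu : algebraMap (C.X.left.presheaf.stalk j.point) C.X.left.functionField u = F)
    (ψ : ℚ →+* C.X.left.presheaf.stalk j.point) : ∃ h : Polynomial ℚ, h ≠ 0 ∧
      h.eval₂ ψ u ∈ IsLocalRing.maximalIdeal (C.X.left.presheaf.stalk j.point) := by
  obtain ⟨g, hg, z, hz⟩ := hM
  obtain ⟨W, hW, hWg, hWM, hgM⟩ := Scheme.PartialMap.toRationalMap_eq_iff.mp hg
  let V : j.D.Opens := j.emb ⁻¹ᵁ M.U
  replace hWM : W ≤ V := hWM
  -- `W` is a dense open set on which the constant representative agrees with `F`; it contains the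
  -- generic point, where the vanishing is read off in the local ring of `X`.
  have hgW : genericPoint j.D ∈ W :=
    ((genericPoint_spec j.D).mem_open_set_iff W.isOpen).mpr (by simpa using hW.nonempty)
  have : Nonempty W := ⟨⟨_, hgW⟩⟩
  let f : Γ(V, ⊤) := V.topIso.inv (j.emb.app M.U M.f)
  have hξ : j.point ∈ M.U := j.point_mem_of_meets M.meets
  let χ : ℚ →+* Γ(C.X.left, M.U) := ((Scheme.ΓSpecIso (.of ℚ)).inv ≫ C.X.hom.appTop ≫
    C.X.left.presheaf.map (homOfLE le_top).op).hom
  obtain ⟨h, h0, hh⟩ := exists_notMem_basicOpen_of_constant (V.ι ≫ j.π)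
    ((j.emb.app M.U ≫ V.topIso.inv).hom.comp χ) f (j.D.homOfLE hWM) z
    (fun w => by
      change (M.partialMap.restrict W hW hWM).hom w = z
      rw [← hgM]
      exact hz _)
  refine ⟨h, h0, ?_⟩
  have := M.nonempty
  have hu' : C.X.left.presheaf.germ M.U _ hξ M.f = u :=
    IsFractionRing.injective (C.X.left.presheaf.stalk j.point) C.X.left.functionField (by
      rw [hu, Scheme.algebraMap_germ_eq_germToFunctionField, M.eq])
  rw [IsLocalRing.mem_maximalIdeal, mem_nonunits_iff]
  intro hunit
  refine hh ⟨_, hgW⟩ ?_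
  have h1 : j.point ∈ C.X.left.basicOpen (h.eval₂ χ M.f) := by
    rw [Scheme.mem_basicOpen _ _ _ hξ]
    have h2 := Polynomial.hom_eval₂ h χ (C.X.left.presheaf.germ M.U _ hξ).hom M.f
    refine h2 ▸ ?_
    convert! hunit using 2
    exact RingHom.ext_rat _ _
  rw [← j.emb_genericPoint] at h1
  have h3 := Polynomial.hom_eval₂ h χ (j.emb.app M.U ≫ V.topIso.inv).hom M.f
  refine h3 ▸ (?_ : j.D.homOfLE hWM ⟨genericPoint j.D, hgW⟩ ∈
    V.toScheme.basicOpen ((j.emb.app M.U ≫ V.topIso.inv).hom (h.eval₂ χ M.f)))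
  have h4 : genericPoint j.D ∈ j.emb ⁻¹ᵁ C.X.left.basicOpen (h.eval₂ χ M.f) := h1
  rw [Scheme.preimage_basicOpen] at h4
  rw [← Scheme.Opens.ι_image_basicOpen_topIso_inv] at h4
  obtain ⟨y, hy, hyy⟩ := h4
  convert! hy
  exact Subtype.ext (congr($(j.D.homOfLE_ι hWM) ⟨genericPoint j.D, hgW⟩).trans hyy.symm)

end Compactification.J
end AxB

end

/-! ### Right translation by the rational points `(u, 0)`. -/

section
open AlgebraicGeometry CategoryTheory TopologicalSpace TensorProduct
open MonoidalCategory CartesianMonoidalCategory MonObj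

namespace AxB
/-- The rational point `(u, 0)` of `G`. -/
noncomputable def scalePoint (u : ℚˣ) : 𝟙_ (Over (Spec (.of ℚ))) ⟶ G :=
  Over.homMk (Spec.map (CommRingCat.ofHom (CoordRing.lift (u : ℚ) 0 u.isUnit).toRingHom)) (by
    change Spec.map _ ≫ Spec.map _ = 𝟙 _
    rw [← Spec.map_comp, ← Spec.map_id]
    congr 1
    ext
    simp)

theorem CoordRing.isUnit_smul_a (u : ℚˣ) : IsUnit ((u : ℚ) • a) := by
  rw [Algebra.smul_def]
  exact (u.isUnit.map _).mul isUnit_a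

/-- The endomorphism of the coordinate ring dual to the right translation by `(u, 0)`. -/
noncomputable def CoordRing.scale (u : ℚˣ) : CoordRing →ₐ[ℚ] CoordRing :=
  lift ((u : ℚ) • a) b (isUnit_smul_a u)

theorem rightMul_scalePoint_left (u : ℚˣ) :
    (lift (𝟙 G) (toUnit G ≫ scalePoint u) ≫ μ[G]).left =
      Spec.map (CommRingCat.ofHom (CoordRing.scale u).toRingHom) := by
  let e : CoordRing →ₐ[ℚ] ℚ := CoordRing.lift (u : ℚ) 0 u.isUnit
  -- `τ` is dual to `g ↦ (g, (u, 0))`, so its composite with the comultiplication is dual to right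
  -- translation.
  let τ : CoordRing ⊗[ℚ] CoordRing →ₐ[ℚ] CoordRing :=
    Algebra.TensorProduct.lift (.id ℚ _) ((Algebra.ofId ℚ CoordRing).comp e) fun _ _ => .all _ _
  have h1 : (lift (𝟙 G) (toUnit G ≫ scalePoint u)).left =
      Spec.map (CommRingCat.ofHom τ.toRingHom) ≫
        (pullbackSpecIso ℚ CoordRing CoordRing).inv := by
    apply Limits.pullback.hom_ext
    · have hfst : (lift (𝟙 G) (toUnit G ≫ scalePoint u)).left ≫
          Limits.pullback.fst G.hom G.hom = 𝟙 _ :=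
        congr(($(lift_fst (𝟙 G) (toUnit G ≫ scalePoint u))).left)
      refine hfst.trans ?_
      refine Eq.trans ?_ ((Category.assoc _ _ _).trans
        congr(Spec.map (CommRingCat.ofHom τ.toRingHom) ≫
          $(pullbackSpecIso_inv_fst ℚ CoordRing CoordRing))).symm
      rw [← Spec.map_comp, ← CommRingCat.ofHom_comp]
      refine (Spec.map_id _).symm.trans ?_
      congr 1
      ext x
      simp [τ]
    · have hsnd : (lift (𝟙 G) (toUnit G ≫ scalePoint u)).left ≫
          Limits.pullback.snd G.hom G.hom = G.hom ≫ (scalePoint u).left :=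
        congr(($(lift_snd (𝟙 G) (toUnit G ≫ scalePoint u))).left)
      refine hsnd.trans ?_
      refine Eq.trans ?_ ((Category.assoc _ _ _).trans
        congr(Spec.map (CommRingCat.ofHom τ.toRingHom) ≫
          $(pullbackSpecIso_inv_snd ℚ CoordRing CoordRing))).symm
      rw [← Spec.map_comp, ← CommRingCat.ofHom_comp]
      refine (Spec.map_comp _ _).symm.trans ?_
      congr 1
      ext x
      simp [τ]
      rfl
  have h2 : CoordRing.scale u = τ.comp (Bialgebra.comulAlgHom ℚ CoordRing) := by
    apply CoordRing.algHom_ext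
    · simp [CoordRing.scale, CoordRing.comul_a, τ, e, Algebra.ofId_apply,
        Algebra.smul_def, mul_comm]
    · simp [CoordRing.scale, CoordRing.comul_b, τ, e]
  have h3 : (Spec.map (CommRingCat.ofHom τ.toRingHom) ≫
      (pullbackSpecIso ℚ CoordRing CoordRing).inv) ≫ (pullbackSpecIso ℚ CoordRing CoordRing).hom ≫
      Spec.map (CommRingCat.ofHom (Bialgebra.comulAlgHom ℚ CoordRing).toRingHom) =
        Spec.map (CommRingCat.ofHom (CoordRing.scale u).toRingHom) := by
    rw [Category.assoc, Iso.inv_hom_id_assoc, ← Spec.map_comp, h2]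
    rfl
  exact congr($h1 ≫ (pullbackSpecIso ℚ CoordRing CoordRing).hom ≫
    Spec.map (CommRingCat.ofHom (Bialgebra.comulAlgHom ℚ CoordRing).toRingHom)).trans h3

namespace Compactification
variable (C : Compactification)

/-- The action of a rational point of `G` on `X`. -/
noncomputable def translate (p : 𝟙_ (Over (Spec (.of ℚ))) ⟶ G) : C.X ⟶ C.X :=
  lift (𝟙 C.X) (toUnit C.X ≫ p) ≫ C.act

theorem lift_lift_act {T : Over (Spec (.of ℚ))} (f : T ⟶ C.X) (x y : T ⟶ G) :
    lift (lift f x ≫ C.act) y ≫ C.act = lift f (lift x y ≫ μ[G]) ≫ C.act := by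
  have h := C.act_mul
  have h1 := congr(lift (lift f x) y ≫ $h)
  simpa using h1

theorem translate_comp (p q : 𝟙_ (Over (Spec (.of ℚ))) ⟶ G) :
    C.translate p ≫ C.translate q = C.translate (lift p q ≫ μ[G]) := by
  unfold translate
  rw [← Category.assoc _ _ C.act, comp_lift]
  simp only [Category.comp_id]
  rw [lift_lift_act]
  simp [comp_lift_assoc]

theorem lift_id_toUnit_comp (p : 𝟙_ (Over (Spec (.of ℚ))) ⟶ G) :
    lift (𝟙 C.X) (toUnit C.X ≫ p) = (ρ_ C.X).inv ≫ C.X ◁ p := by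
  apply CartesianMonoidalCategory.hom_ext <;> simp

theorem translate_one : C.translate η[G] = 𝟙 _ := by
  have h := C.act_one
  have h1 := congr((ρ_ C.X).inv ≫ $h)
  rw [Iso.inv_hom_id] at h1
  rw [← h1, translate, lift_id_toUnit_comp, Category.assoc]

theorem incl_translate (p : 𝟙_ (Over (Spec (.of ℚ))) ⟶ G) :
    C.incl ≫ C.translate p = (lift (𝟙 G) (toUnit G ≫ p) ≫ μ[G]) ≫ C.incl := by
  rw [Category.assoc, ← C.incl_act, translate]
  simp [← Category.assoc]

instance (p : 𝟙_ (Over (Spec (.of ℚ))) ⟶ G) : IsIso (C.translate p) := by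
  refine ⟨C.translate p⁻¹, ?_, ?_⟩
  · rw [translate_comp, ← C.translate_one, ← Hom.mul_def, mul_inv_cancel, Hom.one_def,
      toUnit_unique (toUnit _) (𝟙 _), Category.id_comp]
  · rw [translate_comp, ← C.translate_one, ← Hom.mul_def, inv_mul_cancel, Hom.one_def,
      toUnit_unique (toUnit _) (𝟙 _), Category.id_comp]

end Compactification
end AxB

end

/-! ### The case `e₂ ≠ 0`: scaling symmetries that fix `D_j`. -/

section
open AlgebraicGeometry CategoryTheory TopologicalSpace TensorProduct
open MonoidalCategory CartesianMonoidalCategory MonObj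

/-- Applying `τ` repeatedly to a vanishing `P(u)` makes the residues of all `q ^ n * u` roots of
`P`; they are pairwise distinct, too many for a nonzero polynomial. -/
theorem IsLocalRing.eval₂_notMem_maximalIdeal_of_map_eq_mul {k A : Type*} [Field k] [CommRing A]
    [IsLocalRing A] (ψ : k →+* A) (τ : A →+* A) [IsLocalHom τ] (hτ : τ.comp ψ = ψ) {u : A}
    (hu : IsUnit u) {q : k} (hq : Function.Injective fun n : ℕ => q ^ n)
    (h : τ u = ψ q * u) {P : Polynomial k} (hP : P ≠ 0) :
    P.eval₂ ψ u ∉ maximalIdeal A := by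
  intro hmem
  have h1 (n : ℕ) : P.eval₂ ψ (ψ (q ^ n) * u) ∈ maximalIdeal A := by
    induction n with
    | zero => simpa using hmem
    | succ n ih =>
      have h2 : τ (P.eval₂ ψ (ψ (q ^ n) * u)) ∈ maximalIdeal A := by
        rw [IsLocalRing.mem_maximalIdeal, mem_nonunits_iff] at ih ⊢
        exact fun h => ih (isUnit_of_map_unit τ _ h)
      rwa [Polynomial.hom_eval₂, hτ, map_mul, h, ← _root_.mul_assoc, ← RingHom.comp_apply, hτ,
        ← map_mul, ← pow_succ] at h2
  let χ : k →+* ResidueField A := (residue A).comp ψ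
  have h2 : P.map χ ≠ 0 := (Polynomial.map_ne_zero_iff χ.injective).mpr hP
  refine h2 (Polynomial.eq_zero_of_infinite_isRoot _ ?_)
  refine (Set.infinite_range_of_injective
    (f := fun n : ℕ => residue A (ψ (q ^ n) * u)) ?_).mono ?_
  · intro m n hmn
    simp only [map_mul] at hmn
    exact hq (χ.injective (mul_right_cancel₀ (hu.map (residue A)).ne_zero hmn))
  · rintro _ ⟨n, rfl⟩
    rw [Set.mem_ofPred_eq, Polynomial.IsRoot.def, Polynomial.eval_map, ← Polynomial.hom_eval₂]
    exact (residue_eq_zero_iff _).mpr (h1 n)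

theorem TopologicalSpace.NoetherianSpace.finite_generic {X : Type*} [TopologicalSpace X]
    [NoetherianSpace X] [QuasiSober X] {Z : Set X} (hZ : IsClosed Z) :
    {x ∈ Z | ∀ y ∈ Z, y ⤳ x → y = x}.Finite := by
  obtain ⟨S, hS, hSc, hSi, rfl⟩ :=
    NoetherianSpace.exists_finite_set_isClosed_irreducible hZ
  have : Finite S := hS
  refine (Set.finite_range fun t : S => (hSi t t.2).genericPoint).subset ?_
  rintro x ⟨⟨t, ht, hx⟩, h⟩
  have h1 : IsGenericPoint (hSi t ht).genericPoint t := by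
    have := (hSi t ht).isGenericPoint_genericPoint_closure
    rwa [(hSc t ht).closure_eq] at this
  exact ⟨⟨t, ht⟩, h _ ⟨t, ht, h1.mem⟩ (h1.specializes hx)⟩

namespace AlgebraicGeometry.Scheme
variable {X : Scheme.{0}} (s : X ⟶ X)

/-- The endomorphism of the local ring at a fixed point. -/
noncomputable def stalkEnd {x : X} (h : s x = x) :
    X.presheaf.stalk x ⟶ X.presheaf.stalk x :=
  X.presheaf.stalkSpecializes (specializes_of_eq h) ≫ s.stalkMap x

instance {x : X} (h : s x = x) : IsLocalHom (stalkEnd s h).hom := by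
  have h1 : IsIso (X.presheaf.stalkSpecializes (specializes_of_eq h)) :=
    (X.presheaf.stalkCongr (.of_eq h.symm)).isIso_hom
  unfold stalkEnd
  rw [CommRingCat.hom_comp]
  infer_instance

theorem stalkEnd_stalkSpecializes {x y : X} (hx : s x = x) (hy : s y = y) (h : y ⤳ x) :
    stalkEnd s hx ≫ X.presheaf.stalkSpecializes h =
      X.presheaf.stalkSpecializes h ≫ stalkEnd s hy := by
  have h1 := Scheme.Hom.stalkSpecializes_stalkMap s y x h
  unfold stalkEnd
  rw [Category.assoc, ← h1]
  simp

theorem SpecMap_stalkEnd_fromSpecStalk {x : X} (h : s x = x) :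
    Spec.map (stalkEnd s h) ≫ X.fromSpecStalk x = X.fromSpecStalk x ≫ s := by
  simp [stalkEnd, Scheme.SpecMap_stalkSpecializes_fromSpecStalk,
    Scheme.SpecMap_stalkMap_fromSpecStalk]

theorem apply_genericPoint [IsIntegral X] [Surjective s] : s (genericPoint X) = genericPoint X := by
  obtain ⟨y, hy⟩ := s.surjective (genericPoint X)
  refine Inseparable.eq (Specializes.antisymm ?_ ((genericPoint_spec X).specializes trivial))
  conv_rhs => rw [← hy]
  exact ((genericPoint_spec X).specializes trivial).map s.continuous

/-- This identifies the action of `s` on rational functions coming from the chart `i`, so that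
scalings of `X` can be computed on `a` and `b`. -/
theorem comp_stalkEnd_genericPoint [IsIntegral X] {R : CommRingCat.{0}}
    (i : Spec R ⟶ X) [IsOpenImmersion i] [Nonempty (i ''ᵁ ⊤)] (r : R ⟶ R)
    (hr : i ≫ s = Spec.map r ≫ i) (h : s (genericPoint X) = genericPoint X) :
    ((Scheme.ΓSpecIso R).inv ≫ (i.appIso ⊤).inv ≫ X.germToFunctionField (i ''ᵁ ⊤)) ≫
      stalkEnd s h = r ≫ (Scheme.ΓSpecIso R).inv ≫ (i.appIso ⊤).inv ≫
        X.germToFunctionField (i ''ᵁ ⊤) := by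
  apply Spec.map_injective
  rw [← cancel_mono i, Spec.map_comp, Spec.map_comp r, Category.assoc, Category.assoc,
    SpecMap_germToFunctionField_comp, SpecMap_stalkEnd_fromSpecStalk, ← hr,
    ← SpecMap_germToFunctionField_comp i, Category.assoc]

end AlgebraicGeometry.Scheme

namespace AxB

theorem scalePoint_mul (u v : ℚˣ) :
    lift (scalePoint u) (scalePoint v) ≫ μ[G] = scalePoint (u * v) := by
  have h : lift (scalePoint u) (scalePoint v) ≫ μ[G] =
      scalePoint u ≫ lift (𝟙 G) (toUnit G ≫ scalePoint v) ≫ μ[G] := by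
    rw [← Category.assoc, comp_lift]
    simp [toUnit_unique (toUnit _) (𝟙 _)]
  rw [h]
  ext1
  refine congr((scalePoint u).left ≫ $(rightMul_scalePoint_left v)).trans ?_
  refine (Spec.map_comp _ _).symm.trans ?_
  have h1 : (CoordRing.lift (u : ℚ) 0 u.isUnit).comp (CoordRing.scale v) =
      CoordRing.lift ((u * v : ℚˣ) : ℚ) 0 (u * v).isUnit := by
    apply CoordRing.algHom_ext <;> simp [CoordRing.scale, mul_comm]
  exact congr(Spec.map (CommRingCat.ofHom ($h1).toRingHom))

namespace Compactification
variable (C : Compactification)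

/-- The automorphism of `X` given by the right translation by `(u, 0)`. -/
noncomputable def scaling (u : ℚˣ) : C.X.left ⟶ C.X.left := (C.translate (scalePoint u)).left

instance (u : ℚˣ) : IsIso (C.scaling u) :=
  inferInstanceAs (IsIso ((Over.forget _).map (C.translate (scalePoint u))))

theorem scaling_comp (u v : ℚˣ) : C.scaling u ≫ C.scaling v = C.scaling (u * v) := by
  unfold scaling
  rw [← scalePoint_mul, ← translate_comp]
  rfl

theorem scaling_one : C.scaling 1 = 𝟙 _ := by
  rw [← cancel_mono (C.scaling 1), scaling_comp, Category.id_comp, _root_.mul_one]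

theorem scaling_scaling (u v : ℚˣ) (x : C.X.left) :
    C.scaling v (C.scaling u x) = C.scaling (u * v) x :=
  congr($(C.scaling_comp u v) x)

theorem scaling_one_apply (x : C.X.left) : C.scaling 1 x = x :=
  congr($(C.scaling_one) x)

theorem scaling_injective (u : ℚˣ) : Function.Injective (C.scaling u) := fun x y h => by
  have h1 := congr(C.scaling u⁻¹ $h)
  simpa only [scaling_scaling, mul_inv_cancel, scaling_one_apply] using h1

theorem incl_scaling (u : ℚˣ) : C.incl.left ≫ C.scaling u =
    Spec.map (CommRingCat.ofHom (CoordRing.scale u).toRingHom) ≫ C.incl.left := by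
  have h := congr(($(C.incl_translate (scalePoint u))).left)
  exact h.trans congr($(rightMul_scalePoint_left u) ≫ C.incl.left)

theorem scaling_mem_boundary (u : ℚˣ) {x : C.X.left} (hx : x ∈ C.boundary) :
    C.scaling u x ∈ C.boundary := by
  rintro ⟨g, hg⟩
  refine hx ⟨Spec.map (CommRingCat.ofHom (CoordRing.scale u⁻¹).toRingHom) g, ?_⟩
  refine congr($(C.incl_scaling u⁻¹) g).symm.trans ?_
  change C.scaling u⁻¹ (C.incl.left g) = x
  rw [hg, scaling_scaling, mul_inv_cancel, scaling_one_apply]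

/-- Scalings permute the generic points of the boundary components, of which there are finitely
many, so two powers of `2` move `j.point` to the same place. Any rational number of infinite
multiplicative order would serve. -/
theorem J.exists_scaling_point_eq (j : C.J) : ∃ n : ℕ, n ≠ 0 ∧
    C.scaling (Units.mk0 2 two_ne_zero ^ n) j.point = j.point := by
  set u : ℚˣ := Units.mk0 2 two_ne_zero
  have hfin := NoetherianSpace.finite_generic (J.isClosed_boundary (C := C))
  have hmem (k : ℕ) : C.scaling (u ^ k) j.point ∈
      {x ∈ C.boundary | ∀ y ∈ C.boundary, y ⤳ x → y = x} := by
    refine ⟨C.scaling_mem_boundary _ j.point_mem_boundary, fun y hy hyx => ?_⟩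
    have h1 := hyx.map (C.scaling (u ^ k)⁻¹).continuous
    rw [scaling_scaling, mul_inv_cancel, scaling_one_apply] at h1
    have h2 := j.eq_point_of_specializes h1 (C.scaling_mem_boundary _ hy)
    rw [← h2, scaling_scaling, inv_mul_cancel, scaling_one_apply]
  obtain ⟨k, l, hkl, h⟩ := hfin.exists_lt_map_eq_of_forall_mem hmem
  refine ⟨l - k, by lia, C.scaling_injective (u ^ k) ?_⟩
  rw [scaling_scaling, ← pow_add, Nat.sub_add_cancel hkl.le, h]

theorem stalkEnd_ofG (u : ℚˣ) (h : C.scaling u (genericPoint C.X.left) = genericPoint C.X.left)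
    (r : CoordRing) : (C.X.left.stalkEnd (C.scaling u) h).hom (C.ofG r) =
      C.ofG (CoordRing.scale u r) := by
  let i : Spec (.of CoordRing) ⟶ C.X.left := C.incl.left
  have : IsOpenImmersion i := C.isOpenImmersion
  have : Nonempty (i ''ᵁ ⊤) := inferInstanceAs (Nonempty (C.incl.left ''ᵁ ⊤ : C.X.left.Opens))
  exact congr($(Scheme.comp_stalkEnd_genericPoint (C.scaling u) i
    (CommRingCat.ofHom (CoordRing.scale u).toRingHom) (C.incl_scaling u) h) r)

theorem J.eval₂_notMem_maximalIdeal (j : C.J) (c : ℚ) (e₁ e₂ : ℤ) (he₂ : e₂ ≠ 0)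
    {u : C.X.left.presheaf.stalk j.point} (hu : IsUnit u)
    (huF : algebraMap (C.X.left.presheaf.stalk j.point) C.X.left.functionField u =
      (C.b - (c : C.FunField)) ^ e₁ / C.a ^ e₂)
    (ψ : ℚ →+* C.X.left.presheaf.stalk j.point) {P : Polynomial ℚ} (hP : P ≠ 0) :
    P.eval₂ ψ u ∉ IsLocalRing.maximalIdeal (C.X.left.presheaf.stalk j.point) := by
  obtain ⟨n, hn, hfix⟩ := j.exists_scaling_point_eq
  set t : ℚˣ := Units.mk0 2 two_ne_zero ^ n
  have ht : (t : ℚ) = 2 ^ n := by simp [t]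
  have hgen := C.X.left.apply_genericPoint (C.scaling t)
  let τ := (C.X.left.stalkEnd (C.scaling t) hfix).hom
  let φ : C.FunField →+* C.FunField := (C.X.left.stalkEnd (C.scaling t) hgen).hom
  have hb : φ C.b = C.b := by
    refine (C.stalkEnd_ofG t hgen _).trans ?_
    simp [CoordRing.scale, b]
  have ha : φ C.a = (t : ℚ) * C.a := by
    refine (C.stalkEnd_ofG t hgen _).trans ?_
    simp [CoordRing.scale, a, Algebra.smul_def]
  -- Scaling fixes `b - c` and multiplies `a` by `t`, hence multiplies `F` by `t ^ (-e₂)`, which is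
  -- not a root of unity since `t = 2 ^ n > 1` and `e₂ ≠ 0`.
  refine IsLocalRing.eval₂_notMem_maximalIdeal_of_map_eq_mul ψ τ (RingHom.ext_rat _ _) hu
    (q := (t : ℚ) ^ (-e₂)) ?_ ?_ hP
  · have h2 : (t : ℚ) ≠ 1 := by
      rw [ht]
      exact (one_lt_pow₀ one_lt_two hn).ne'
    have h3 : (0 : ℚ) < t := by rw [ht]; positivity
    refine pow_right_injective₀ (zpow_pos h3 _) fun h4 => he₂ ?_
    simpa using (zpow_eq_one_iff_right₀ h3.le h2).mp h4
  · apply IsFractionRing.injective (C.X.left.presheaf.stalk j.point) C.X.left.functionField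
    have h5 : algebraMap (C.X.left.presheaf.stalk j.point) C.X.left.functionField (τ u) =
        φ (algebraMap (C.X.left.presheaf.stalk j.point) C.X.left.functionField u) :=
      congr($(Scheme.stalkEnd_stalkSpecializes (C.scaling t) hfix hgen
        ((genericPoint_spec C.X.left).specializes trivial)) u)
    have h6 (q : ℚ) : algebraMap (C.X.left.presheaf.stalk j.point) C.X.left.functionField
        (ψ q) = q :=
      eq_ratCast ((algebraMap _ _).comp ψ) q
    rw [h5, map_mul, h6, huF, map_div₀, map_zpow₀, map_zpow₀, map_sub, hb, ha, map_ratCast,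
      mul_zpow]
    push_cast
    rw [zpow_neg]
    field_simp

end Compactification

end AxB

end

/-! ### The case `e₂ = 0`: geometric irreducibility makes algebraic values rational. -/

section
open AlgebraicGeometry CategoryTheory TopologicalSpace TensorProduct

theorem RingHom.map_units_zpow {R K : Type*} [Ring R] [DivisionRing K] (f : R →+* K) (u : Rˣ)
    (n : ℤ) : f (u ^ n : Rˣ) = f u ^ n := by
  have h := congr(($(map_zpow (Units.map (f : R →* K)) u n) : K))
  rwa [Units.val_zpow_eq_zpow_val] at h

/-- Over `L = k[α]` with `P(α) = 0`, write `P = (X - α) Q`. The product `(x - α) Q(x) = P(x)` is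
nilpotent in `R ⊗ L`, so one factor is. Evaluating in an algebraically closed field, the first
factor leaves `P` a single root, and the second gives `P` a double root. -/
theorem Polynomial.natDegree_eq_one_of_isPrime_nilradical_tensorProduct {k R : Type*} [Field k]
    [CommRing R] [Algebra k R] [Nontrivial R] {P : Polynomial k} (hP : Irreducible P)
    (hsep : P.Separable) [Fact (Irreducible P)] (hn : (nilradical (R ⊗[k] AdjoinRoot P)).IsPrime)
    {x : R} (hx : IsNilpotent (aeval x P)) : P.natDegree = 1 := by
  obtain ⟨m, hm⟩ := Ideal.exists_maximal R
  let _ := Ideal.Quotient.field m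
  let Ω := AlgebraicClosure (R ⧸ m)
  let ρ : R →ₐ[k] Ω := (IsScalarTower.toAlgHom k (R ⧸ m) Ω).comp (Ideal.Quotient.mkₐ k m)
  have hρ : aeval (ρ x) P = 0 := by
    rw [aeval_algHom_apply]
    exact (hx.map ρ).eq_zero
  -- Each root `r` of `P` in `Ω` gives a point of `R ⊗ L` with `x ↦ ρ x` and `α ↦ r`; the value of
  -- `x` does not depend on `r`.
  let θ (r : Ω) (hr : aeval r P = 0) : R ⊗[k] AdjoinRoot P →ₐ[k] Ω :=
    Algebra.TensorProduct.lift ρ (AdjoinRoot.liftAlgHom P (Algebra.ofId k Ω) r hr)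
      fun _ _ => .all _ _
  let L := AdjoinRoot P
  let i₁ : R →ₐ[k] R ⊗[k] L := Algebra.TensorProduct.includeLeft
  let i₂ : L →ₐ[k] R ⊗[k] L := Algebra.TensorProduct.includeRight
  obtain ⟨Q, hQ⟩ : X - C (AdjoinRoot.root P) ∣ P.map (algebraMap k L) := by
    rw [dvd_iff_isRoot, IsRoot.def, eval_map_algebraMap]
    exact (AdjoinRoot.aeval_eq P).trans AdjoinRoot.mk_self
  have hprod : (i₁ x - i₂ (AdjoinRoot.root P)) * Q.eval₂ i₂ (i₁ x) = i₁ (aeval x P) := by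
    have h1 := congr(eval₂ (i₂ : L →+* R ⊗[k] L) (i₁ x) $hQ)
    rw [eval₂_mul, eval₂_sub, eval₂_X, eval₂_C, eval₂_map] at h1
    refine h1.symm.trans ?_
    rw [← aeval_algHom_apply, aeval_def]
    congr 1
    exact i₂.comp_algebraMap
  have hmem : (i₁ x - i₂ (AdjoinRoot.root P)) * Q.eval₂ i₂ (i₁ x) ∈ nilradical (R ⊗[k] L) := by
    rw [hprod]
    exact hx.map i₁
  obtain h | h := hn.mem_or_mem hmem
  · have hroots : (P.aroots Ω).card = P.natDegree := by
      rw [aroots, ← (IsAlgClosed.splits _).natDegree_eq_card_roots, natDegree_map]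
    have hle : (P.aroots Ω) ≤ {ρ x} := by
      rw [Multiset.le_iff_subset
        (nodup_aroots_iff_of_splits hP.ne_zero (IsAlgClosed.splits _) |>.mpr hsep)]
      intro r hr
      have hr' : aeval r P = 0 := ((mem_aroots (S := Ω)).mp hr).2
      have h2 := (IsNilpotent.map h (θ r hr')).eq_zero
      simp only [θ, i₁, i₂, L, sub_eq_zero, map_sub, Algebra.TensorProduct.includeLeft_apply,
        Algebra.TensorProduct.includeRight_apply, Algebra.TensorProduct.lift_tmul, map_one,
        mul_one, one_mul] at h2
      exact Multiset.mem_singleton.mpr (h2.trans (AdjoinRoot.lift_root hr')).symm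
    have := Multiset.card_le_card hle
    have := hP.natDegree_pos
    simp at *
    lia
  · exfalso
    -- Choosing the root `r = ρ x` makes `ρ x` a zero of both `X - α` and `Q`, against separability.
    let σ : L →ₐ[k] Ω := AdjoinRoot.liftAlgHom P (Algebra.ofId k Ω) (ρ x) hρ
    have h2 : Q.eval₂ (σ : L →+* Ω) (ρ x) = 0 := by
      have := (IsNilpotent.map h (θ (ρ x) hρ)).eq_zero
      replace this := (hom_eval₂ Q (i₂ : L →+* R ⊗[k] L)
        (θ (ρ x) hρ : R ⊗[k] L →+* Ω) (i₁ x)).symm.trans this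
      convert! this using 2
      · ext <;> simp [θ, i₂, σ, L]
      · simp [θ, i₁]
    have h3 : P.map (algebraMap k Ω) = (X - C (ρ x)) * Q.map (σ : L →+* Ω) := by
      have := congr(map (σ : L →+* Ω) $hQ)
      rw [map_map, Polynomial.map_mul] at this
      convert! this using 2
      · exact σ.comp_algebraMap.symm
      · have h : σ (AdjoinRoot.root P) = ρ x := AdjoinRoot.lift_root hρ
        simp [h]
    have h4 := hsep.map (f := algebraMap k Ω)
    have h5 := h4.eval₂_derivative_ne_zero (RingHom.id Ω) (x := ρ x) (by simp [h3])
    apply h5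
    rw [h3]
    simp [eval_map, h2]

namespace AlgebraicGeometry

theorem natDegree_eq_one_of_isNilpotent_aeval {k R : Type} [Field k] [CommRing R] [Algebra k R]
    [Nontrivial R] [GeometricallyIrreducible (Spec.map (CommRingCat.ofHom (algebraMap k R)))]
    {P : Polynomial k} (hP : Irreducible P) (hsep : P.Separable) {x : R}
    (hx : IsNilpotent (Polynomial.aeval x P)) : P.natDegree = 1 := by
  have : Fact (Irreducible P) := ⟨hP⟩
  refine P.natDegree_eq_one_of_isPrime_nilradical_tensorProduct hP hsep ?_ hx
  rw [← PrimeSpectrum.irreducibleSpace_iff_isPrime_nilradical]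
  have h := pullback_of_geometrically (GeometricallyIrreducible.geometrically_irreducibleSpace
    (f := Spec.map (CommRingCat.ofHom (algebraMap k R)))) (AdjoinRoot P)
    (Spec.map (CommRingCat.ofHom (algebraMap k (AdjoinRoot P))))
  exact (pullbackSpecIso k R (AdjoinRoot P)).hom.homeomorph.irreducibleSpace_iff.mp h

/-- A function vanishing at the generic point vanishes at every point, so it is nilpotent on an
affine neighbourhood. -/
theorem natDegree_eq_one_of_notMem_basicOpen {T : Scheme.{0}} [IrreducibleSpace T] {k : Type}
    [Field k] (π : T ⟶ Spec (.of k)) [GeometricallyIrreducible π] (U : T.Opens)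
    (hU : genericPoint T ∈ U) (χ : k →+* Γ(T, U))
    (hχ : χ = ((Scheme.ΓSpecIso (.of k)).inv ≫ π.appLE ⊤ U le_top).hom) (f : Γ(T, U))
    {P : Polynomial k} (hP : Irreducible P) (hsep : P.Separable)
    (h : genericPoint T ∉ T.basicOpen (P.eval₂ χ f)) : P.natDegree = 1 := by
  obtain ⟨_, ⟨V, hV, rfl⟩, hgV, hVU⟩ :=
    T.isBasis_affineOpens.exists_subset_of_mem_open hU U.isOpen
  replace hV : IsAffineOpen V := hV
  replace hVU : V ≤ U := hVU
  let ρ : Γ(T, U) ⟶ Γ(T, V) := T.presheaf.map (homOfLE hVU).op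
  let _ : Algebra k Γ(T, V) := (ρ.hom.comp χ).toAlgebra
  have hnt : Nontrivial Γ(T, V) := (T.presheaf.germ V _ hgV).hom.domain_nontrivial
  have hπ : hV.fromSpec ≫ π = Spec.map (CommRingCat.ofHom (algebraMap k Γ(T, V))) := by
    have h1 := IsAffineOpen.SpecMap_appLE_fromSpec π (isAffineOpen_top _) hV le_top
    rw [IsAffineOpen.fromSpec_top, Scheme.isoSpec_Spec_inv, ← Spec.map_comp] at h1
    rw [← h1]
    congr 1
    ext1
    change _ = ρ.hom.comp χ
    rw [hχ, ← CommRingCat.hom_comp, Category.assoc]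
    congr 2
    exact (π.appLE_map le_top _).symm
  have : Nonempty (Spec Γ(T, V)) := inferInstanceAs (Nonempty (PrimeSpectrum Γ(T, V)))
  have : Subsingleton (Spec (.of k)) := inferInstanceAs (Subsingleton (PrimeSpectrum k))
  have : Surjective (hV.fromSpec ≫ π) :=
    ⟨fun y => ⟨Classical.arbitrary _, Subsingleton.elim _ _⟩⟩
  have : GeometricallyIrreducible (Spec.map (CommRingCat.ofHom (algebraMap k Γ(T, V)))) :=
    hπ ▸ inferInstance
  refine natDegree_eq_one_of_isNilpotent_aeval (R := Γ(T, V)) hP hsep (x := ρ f) ?_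
  have h2 : Polynomial.aeval (ρ f) P = ρ (P.eval₂ χ f) := (Polynomial.hom_eval₂ P χ ρ.hom f).symm
  rw [h2, Scheme.isNilpotent_iff_basicOpen_eq_bot_of_isCompact hV.isCompact, eq_bot_iff]
  refine (Scheme.basicOpen_res T _ _).le.trans ?_
  rintro x ⟨-, hx⟩
  exact h (((genericPoint_spec T).mem_open_set_iff (T.basicOpen _).isOpen).mpr ⟨x, trivial, hx⟩)

end AlgebraicGeometry

namespace AxB.Compactification.J
variable {C : Compactification} (j : C.J)

theorem natDegree_eq_one_of_eval₂_mem_maximalIdeal [GeometricallyIrreducible j.π]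
    (ψ : ℚ →+* C.X.left.presheaf.stalk j.point) (u : C.X.left.presheaf.stalk j.point)
    {P : Polynomial ℚ} (hP : Irreducible P)
    (h : P.eval₂ ψ u ∈ IsLocalRing.maximalIdeal (C.X.left.presheaf.stalk j.point)) :
    P.natDegree = 1 := by
  obtain ⟨U, hU, f, hf⟩ := C.X.left.presheaf.exists_germ_eq u
  let χ : ℚ →+* Γ(C.X.left, U) :=
    ((Scheme.ΓSpecIso (.of ℚ)).inv ≫ C.X.hom.appLE ⊤ U le_top).hom
  have hgU : genericPoint j.D ∈ j.emb ⁻¹ᵁ U := by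
    change j.emb (genericPoint j.D) ∈ U
    rwa [emb_genericPoint]
  refine natDegree_eq_one_of_notMem_basicOpen j.π (j.emb ⁻¹ᵁ U) hgU
    ((j.emb.app U).hom.comp χ) (RingHom.ext_rat _ _) (j.emb.app U f) hP hP.separable ?_
  have h1 := Polynomial.hom_eval₂ P χ (j.emb.app U).hom f
  rw [← h1]
  refine fun hmem => (IsLocalRing.mem_maximalIdeal _).mp h ?_
  have hmem' : genericPoint j.D ∈ j.emb ⁻¹ᵁ C.X.left.basicOpen (P.eval₂ χ f) := by
    rwa [Scheme.preimage_basicOpen]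
  replace hmem' : j.emb (genericPoint j.D) ∈ C.X.left.basicOpen (P.eval₂ χ f) := hmem'
  rw [emb_genericPoint, Scheme.mem_basicOpen _ _ _ hU] at hmem'
  have h2 := Polynomial.hom_eval₂ P χ (C.X.left.presheaf.germ U _ hU).hom f
  convert! h2 ▸ hmem' using 2
  · exact RingHom.ext_rat _ _
  · exact hf.symm

/-- The residue of `u ^ n` is algebraic over `ℚ`, hence so is that of `u`. Its minimal polynomial
vanishes at the generic point of `D_j`, so it is linear. -/
theorem exists_sub_mem_maximalIdeal [GeometricallyIrreducible j.π]
    (ψ : ℚ →+* C.X.left.presheaf.stalk j.point) (u : (C.X.left.presheaf.stalk j.point)ˣ)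
    {n : ℤ} (hn : n ≠ 0) {P : Polynomial ℚ} (hP : P ≠ 0)
    (h : P.eval₂ ψ (u ^ n : (C.X.left.presheaf.stalk j.point)ˣ) ∈
      IsLocalRing.maximalIdeal (C.X.left.presheaf.stalk j.point)) :
    ∃ q : ℚ, (u : C.X.left.presheaf.stalk j.point) - ψ q ∈
      IsLocalRing.maximalIdeal (C.X.left.presheaf.stalk j.point) := by
  let A := C.X.left.presheaf.stalk j.point
  let _ : Algebra ℚ A := ψ.toAlgebra
  let ρ : A →ₐ[ℚ] IsLocalRing.ResidueField A := IsScalarTower.toAlgHom ℚ A _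
  have h1 : IsAlgebraic ℚ (ρ u ^ n) := by
    refine ⟨P, hP, ?_⟩
    have h2 := (IsLocalRing.residue_eq_zero_iff _).mpr h
    have h3 : ρ (Polynomial.aeval ((u ^ n : Aˣ) : A) P) = 0 := h2
    rw [← Polynomial.aeval_algHom_apply] at h3
    convert! h3
    exact (ρ.toRingHom.map_units_zpow u n).symm
  have h4 : IsAlgebraic ℚ (ρ u) := by
    obtain hn | hn := hn.lt_or_gt
    · rw [← neg_neg n, zpow_neg] at h1
      lift -n to ℕ using by lia with m hm
      refine .of_pow (n := m) (by lia) (by simpa using h1.inv)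
    · lift n to ℕ using hn.le
      refine .of_pow (n := n) (by lia) (by simpa using h1)
  have h5 : (minpoly ℚ (ρ u)).natDegree = 1 := by
    refine j.natDegree_eq_one_of_eval₂_mem_maximalIdeal ψ u (minpoly.irreducible h4.isIntegral) ?_
    rw [← IsLocalRing.residue_eq_zero_iff]
    change ρ (Polynomial.aeval (u : A) (minpoly ℚ (ρ u))) = 0
    rw [← Polynomial.aeval_algHom_apply, minpoly.aeval]
  obtain ⟨q, hq⟩ := minpoly.natDegree_eq_one_iff.mp h5
  refine ⟨q, ?_⟩
  rw [← IsLocalRing.residue_eq_zero_iff]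
  change ρ ((u : A) - algebraMap ℚ A q) = 0
  rw [map_sub, AlgHom.commutes, hq, sub_self]

end AxB.Compactification.J

end

/-! ### Conclusion: `F` is a unit along `D_j`, and both cases of nonconstancy. -/

theorem mainTheorem4 (C : AxB.Compactification) (j : C.J) (c : ℚ) (hc : c ∈ j.argmaxOrd)
    (e₁ e₂ : ℤ) (he₁ : e₁ = j.ord C.a) (he₂ : e₂ = j.ord (C.b - (c : C.FunField)))
    (F : C.FunField) (hF : F = (C.b - (c : C.FunField)) ^ e₁ / C.a ^ e₂) :
    Order.coheight j.point = 1 ∧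
    Nonempty (j.UnitNear F) ∧
    ((AlgebraicGeometry.GeometricallyIrreducible j.π ∨ e₂ ≠ 0) →
      ∀ M : j.UnitNear F, ¬ AxB.IsConstant M.ratMap) := by
  have hcoh : Order.coheight j.point = 1 :=
    AlgebraicGeometry.Scheme.coheight_eq_one_of_isDiscreteValuationRing
  have hb := C.b_sub_ne_zero c
  have hF0 : F ≠ 0 := hF ▸ div_ne_zero (zpow_ne_zero _ hb) (zpow_ne_zero _ C.a_ne_zero)
  have hord : j.ord F = 0 := by
    have h1 : j.ord F = e₁ * j.ord (C.b - (c : C.FunField)) + -e₂ * j.ord C.a := by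
      rw [hF, div_eq_mul_inv, ← zpow_neg]
      exact (AlgebraicGeometry.Scheme.ord_mul (zpow_ne_zero _ hb)
        (zpow_ne_zero _ C.a_ne_zero)).trans (congr_arg₂ _ (AlgebraicGeometry.Scheme.ord_zpow hb _)
          (AlgebraicGeometry.Scheme.ord_zpow C.a_ne_zero _))
    rw [h1, ← he₁, ← he₂]
    ring
  obtain ⟨u, hu⟩ := j.exists_algebraMap_eq hF0 hord
  obtain ⟨ψ⟩ := AxB.Compactification.J.exists_ringHom_rat C j.point
  refine ⟨hcoh, j.nonempty_unitNear u hu, fun hor M hM => ?_⟩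
  obtain ⟨P, hP, hmem⟩ := j.exists_eval₂_mem_maximalIdeal M hM u hu ψ
  by_cases h2 : e₂ = 0
  · have := hor.resolve_right (not_not.mpr h2)
    rw [he₂] at h2
    have h1 : e₁ ≠ 0 := he₁ ▸ j.ord_a_ne_zero c h2
    obtain ⟨v, hv⟩ := j.exists_algebraMap_eq hb h2
    let i := algebraMap (C.X.left.presheaf.stalk j.point) C.X.left.functionField
    have hi : Function.Injective i := IsFractionRing.injective _ _
    -- With `e₂ = 0` the denominator of `F` is `1`, so `F` is a nontrivial power of the unit `b -
    -- c`.
    have huv : u = v ^ e₁ := Units.ext (hi (by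
      refine hu.trans (Eq.trans ?_ (i.map_units_zpow v e₁).symm)
      rw [show i v = _ from hv, hF, he₂, h2, zpow_zero, div_one]))
    rw [huv] at hmem
    obtain ⟨q, hq⟩ := j.exists_sub_mem_maximalIdeal ψ v h1 hP hmem
    have hvq : i (v - ψ q) = C.b - ((c + q : ℚ) : C.FunField) := by
      rw [map_sub, show i v = _ from hv, show i (ψ q) = q from eq_ratCast (i.comp ψ) q]
      push_cast
      ring
    have hne : (v : C.X.left.presheaf.stalk j.point) - ψ q ≠ 0 := fun h =>
      C.b_sub_ne_zero (c + q) (by rw [← hvq, h, map_zero])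
    have hpos := AlgebraicGeometry.Scheme.ord_algebraMap_pos hne hq
    -- The competitor `c + q` has positive order, while the maximal order `e₂` is `0`.
    have := hc (c + q)
    rw [← hvq, h2] at this
    exact this.not_gt hpos
  · exact AxB.Compactification.J.eval₂_notMem_maximalIdeal C j c e₁ e₂ h2 u.isUnit
      (hu.trans hF) ψ hP hmem
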